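/- Let $q$ be a prime power, $n\ge 1$, $F=\mathbb F_q$ and $L=\mathbb F_{q^n}$. The points of $\mathrm{PG}(2,q^n)$ are the one-dimensional $L$-subspaces of $L^3$, and the points of $\mathrm{PG}(3n-1,q)$ are the one-dimensional $F$-subspaces of $L^3$. For a point $X$ of $\mathrm{PG}(2,q^n)$ let $\mathcal F(X)$ be the $(n-1)$-subspace of $\mathrm{PG}(3n-1,q)$ given by $X$ regarded as an $F$-subspace of $L^3$. Let $l_\infty$ be a line of $\mathrm{PG}(2,q^n)$, let $H_\infty$ be the span of all $\mathcal F(X)$ with $X\in l_\infty$, and let $\mathcal K$ be a $2n$-subspace of $\mathrm{PG}(3n-1,q)$ containing $\mathcal F(X)$ for every $X\in l_\infty$. For a point $X\notin l_\infty$ let $\varphi(X)=\mathcal F(X)\cap\mathcal K$, which is a single point of the affine space $\mathcal K\setminus H_\infty$; for a set $S$ of points not on $l_\infty$ put $\varphi(S)=\{\varphi(X): X\in S\}$. A $q$-subplane is a set of points of $\mathrm{PG}(2,q^n)$ consisting of the points that have coordinates in $F$ with respect to some $L$-basis of $L^3$; a line of it is the set of its points on a line of $\mathrm{PG}(2,q^n)$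 that contains at least two of its points. If $b$ is such a line, $\langle b\rangle$ is the line of $\mathrm{PG}(2,q^n)$ spanned by $b$. For $\Theta\in\langle b\rangle\setminus b$ the degree $[\Theta:b]$ is $[F(\zeta):F]$, where $(1,\zeta)$ are homogeneous coordinates of $\Theta$ with respect to a reference frame of $\langle b\rangle$ consisting of three points of $b$ (this does not depend on the frame). A normal rational curve of order $d$ is a set of points of the form $$\Big\{\Big\langle \sum_{i=0}^{d}s^{d-i}t^{i}c_i\Big\rangle_F : (s,t)\in F^2\setminus\{0\}\Big\}$$ with $c_0,\dots,c_d\in L^3$ linearly independent over $F$; the map taking $\langle (s,t)\rangle_F$ to $\langle\sum_i s^{d-i}t^ic_i\rangle_F$ is a parametrization of it. A map $\kappa: C_0\to C_1$ between normal rational curves is called a projectivity if there are parametrizations $\gamma_0$ of $C_0$ and $\gamma_1$ of $C_1$ and a projectivity $g$ of $\mathrm{PG}(1,q)$ such that $\gamma_0(p)^\kappa=\gamma_1(g(p))$ for all $p\in\mathrm{PG}(1,q)$. **Theorem.** Let $B$ be a $q$-subplane of $\mathrm{PG}(2,q^n)$ with $B\cap l_\infty=\{T\}$, let $b$ be a line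 of $B$ with $T\notin b$, let $\Theta$ be the point $\langle b\rangle\cap l_\infty$, and put $\delta=\min\{q,[\Theta:b]\}$. Then $\varphi(\langle b\rangle\setminus l_\infty)$ is an affine $n$-subspace, that is, it equals $N\setminus H_\infty$ for some $n$-subspace $N$ of $\mathrm{PG}(3n-1,q)$. There are an integer $\delta'$, a normal rational curve $C_0\subset\varphi(\langle b\rangle\setminus l_\infty)$ of order $\delta$, a normal rational curve $C_1\subset\mathcal F(T)$ of order $\delta'$, and a projectivity $\kappa: C_0\to C_1$ such that * $\delta'=[\Theta:b]-1$ if $q>[\Theta:b]$, and $\delta'\in\{q-1,q\}$ if $q\le[\Theta:b]$; * $\varphi(B\setminus l_\infty)$ is the affine part of the ruled surface formed by the lines $XX^\kappa$: $$\varphi(B\setminus l_\infty)=\Big(\bigcup_{X\in C_0}XX^\kappa\Big)\setminus H_\infty .$$ -/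

import Mathlib

open scoped LinearAlgebra.Projectivization

/-- Points of `PG(2, q^n)` are the points of `ℙ L (Fin 3 → L)`, where `F` has `q` elements and
`L` has degree `n` over `F`; points of `PG(3n-1, q)` are those of `ℙ F (Fin 3 → L)`.
The field reduction of a point `X` of `ℙ L V`: the one-dimensional `L`-subspace `X`, viewed as a
subspace of the projective space of the `F`-vector space `V`. -/
def fieldReduction (F : Type*) {L V : Type*} [Field F] [Field L] [Algebra F L] [AddCommGroup V]
    [Module F V] [Module L V] [IsScalarTower F L V] (X : ℙ L V) : Projectivization.Subspace F V :=
  (X.submodule.restrictScalars F).projectivization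

/-- The `F`-subspace generated by the field reductions of the points of an `L`-subspace `S`. -/
def reducedSpan (F : Type*) {L V : Type*} [Field F] [Field L] [Algebra F L] [AddCommGroup V]
    [Module F V] [Module L V] [IsScalarTower F L V] (S : Projectivization.Subspace L V) :
    Projectivization.Subspace F V :=
  ⨆ X ∈ S, fieldReduction F X

/-- The points of `ℙ L V` whose coordinates with respect to the vectors `e i` can be chosen
in `F`. -/
def rationalPoints (F : Type*) {L V : Type*} [Field F] [Field L] [Algebra F L] [AddCommGroup V]
    [Module L V] {d : ℕ} (e : Fin d → V) : Set (ℙ L V) :=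
  {X | ∃ a : Fin d → F, X.submodule = Submodule.span L {∑ i, algebraMap F L (a i) • e i}}

/-- A `q`-subplane, with `q` the order of `F`. -/
def IsSubplane (F : Type*) {L V : Type*} [Field F] [Field L] [Algebra F L] [AddCommGroup V]
    [Module L V] (B : Set (ℙ L V)) : Prop :=
  ∃ e : Fin 3 → V, LinearIndependent L e ∧ B = rationalPoints F e

/-- `b` is a line of the subplane `B`: the set of points of `B` on a line of `ℙ L V` that joins
two points of `B`. -/
def IsLineOf {L V : Type*} [Field L] [AddCommGroup V] [Module L V] (b B : Set (ℙ L V)) : Prop :=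
  ∃ l : Projectivization.Subspace L V, Module.finrank L l.submodule = 2 ∧
    b = B ∩ (l : Set (ℙ L V)) ∧ b.Nontrivial

/-- The degree `[Θ : b]` of a point `Θ` over a `q`-subline `b`, for `Θ` on the line spanned by `b`:
the degree over `F` of `ζ`, where `(1, ζ)` are homogeneous coordinates of `Θ` with respect to a
coordinate frame `⟨e 0⟩, ⟨e 1⟩, ⟨e 0 + e 1⟩` of points of `b`. The set below has only one
element (see `pointDegree_eq`). -/
noncomputable def pointDegree (F : Type*) {L V : Type*} [Field F] [Field L] [Algebra F L]
    [AddCommGroup V] [Module L V] (Θ : ℙ L V) (b : Set (ℙ L V)) : ℕ :=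
  sInf {m | ∃ (e : Fin 2 → V) (ζ : L), LinearIndependent L e ∧ b = rationalPoints F e ∧
    Θ.submodule = Submodule.span L {e 0 + ζ • e 1} ∧
    m = Module.finrank F (IntermediateField.adjoin F {ζ})}

/-- The André-Bruck-Bose representation `φ(X) = F(X) ∩ K` of a point `X`, as a set of points;
for `X` off the line at infinity it consists of exactly one point
(see `existsUnique_mem_abbPoint`). -/
def abbPoint {F L V : Type*} [Field F] [Field L] [Algebra F L] [AddCommGroup V]
    [Module F V] [Module L V] [IsScalarTower F L V] (K : Projectivization.Subspace F V)
    (X : ℙ L V) : Set (ℙ F V) :=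
  (fieldReduction F X : Set (ℙ F V)) ∩ (K : Set (ℙ F V))

/-- The image under `φ` of a set `S` of points, all off the line at infinity. -/
def abbImage {F L V : Type*} [Field F] [Field L] [Algebra F L] [AddCommGroup V]
    [Module F V] [Module L V] [IsScalarTower F L V] (K : Projectivization.Subspace F V)
    (S : Set (ℙ L V)) : Set (ℙ F V) :=
  ⋃ X ∈ S, abbPoint K X

/-- `γ` is a parametrization of a normal rational curve of order `δ`: in suitable homogeneous
coordinates of a `δ`-subspace, `γ (s, t) = (s ^ δ, s ^ (δ - 1) t, …, t ^ δ)`. -/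
def IsNRCParametrization {F V : Type*} [Field F] [AddCommGroup V] [Module F V] (δ : ℕ)
    (γ : ℙ F (Fin 2 → F) → ℙ F V) : Prop :=
  ∃ c : Fin (δ + 1) → V, LinearIndependent F c ∧ ∀ (v : Fin 2 → F) (hv : v ≠ 0),
    (γ (Projectivization.mk F v hv)).submodule =
      Submodule.span F {∑ i : Fin (δ + 1), (v 0 ^ (δ - (i : ℕ)) * v 1 ^ (i : ℕ)) • c i}

/-- `C` is a normal rational curve of order `δ`. -/
def IsNormalRationalCurve {F V : Type*} [Field F] [AddCommGroup V] [Module F V] (δ : ℕ)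
    (C : Set (ℙ F V)) : Prop :=
  ∃ γ : ℙ F (Fin 2 → F) → ℙ F V, IsNRCParametrization δ γ ∧ C = Set.range γ

/-- `κ` is a projectivity between the normal rational curves `C₀` and `C₁` of orders `δ₀` and
`δ₁`: it is induced by a projectivity between the parametrizing projective lines. -/
def IsCurveProjectivity {F V : Type*} [Field F] [AddCommGroup V] [Module F V] (δ₀ δ₁ : ℕ)
    {C₀ C₁ : Set (ℙ F V)} (κ : C₀ → C₁) : Prop :=
  ∃ γ₀ γ₁ : ℙ F (Fin 2 → F) → ℙ F V,
    IsNRCParametrization δ₀ γ₀ ∧ C₀ = Set.range γ₀ ∧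
    IsNRCParametrization δ₁ γ₁ ∧ C₁ = Set.range γ₁ ∧
    ∃ g : (Fin 2 → F) ≃ₗ[F] (Fin 2 → F), ∀ (p : ℙ F (Fin 2 → F)) (X : C₀),
      (X : ℙ F V) = γ₀ p →
        (κ X : ℙ F V) = γ₁ (Projectivization.map g.toLinearMap g.injective p)

theorem mem_adjoin_of_frames {F L V : Type*} [Field F] [Field L] [Algebra F L]
    [AddCommGroup V] [Module L V] {Θ : ℙ L V} {e e' : Fin 2 → V} {ζ ζ' : L}
    (he : LinearIndependent L e) (he' : LinearIndependent L e')
    (h : (rationalPoints F e : Set (ℙ L V)) = rationalPoints F e')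
    (hΘ : Θ.submodule = Submodule.span L {e 0 + ζ • e 1})
    (hΘ' : Θ.submodule = Submodule.span L {e' 0 + ζ' • e' 1}) :
    ζ' ∈ IntermediateField.adjoin F {ζ} := by
  replace he' : ∀ s t : L, s • e' 0 + t • e' 1 = 0 → s = 0 ∧ t = 0 := by
    intro s t hst
    have hz := Fintype.linearIndependent_iff.1 he' ![s, t] (by simpa [Fin.sum_univ_two] using hst)
    exact ⟨hz 0, hz 1⟩
  have he2 : ∀ s t : L, s • e 0 + t • e 1 = 0 → s = 0 ∧ t = 0 := by
    intro s t hst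
    have hz := Fintype.linearIndependent_iff.1 he ![s, t] (by simpa [Fin.sum_univ_two] using hst)
    exact ⟨hz 0, hz 1⟩
  have key : ∀ a : Fin 2 → F, ∑ i : Fin 2, algebraMap F L (a i) • e' i ≠ 0 →
      ∃ (k : L) (p r : F), ∑ i : Fin 2, algebraMap F L (a i) • e' i =
        (k * algebraMap F L p) • e 0 + (k * algebraMap F L r) • e 1 := by
    intro a ha
    have : Projectivization.mk L _ ha ∈ rationalPoints F e := by
      rw [h]; exact ⟨a, rfl⟩
    obtain ⟨c, hc⟩ := this
    rw [Projectivization.submodule_mk] at hc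
    have hm := Submodule.mem_span_singleton_self (R := L) (∑ i : Fin 2, algebraMap F L (a i) • e' i)
    rw [hc] at hm
    obtain ⟨k, hk⟩ := Submodule.mem_span_singleton.1 hm
    refine ⟨k, c 0, c 1, ?_⟩
    rw [← hk]
    simp [Fin.sum_univ_two, smul_add, smul_smul]
  obtain ⟨l, a, c, h0⟩ := key ![1, 0] (by
    intro h0
    have := he' 1 0 (by simpa [Fin.sum_univ_two] using h0)
    simp at this)
  obtain ⟨m, p, r, h1⟩ := key ![0, 1] (by
    intro h0
    have := he' 0 1 (by simpa [Fin.sum_univ_two] using h0)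
    simp at this)
  obtain ⟨v, s, t, h2⟩ := key ![1, 1] (by
    intro h0
    have := he' 1 1 (by simpa [Fin.sum_univ_two] using h0)
    simp at this)
  simp only [Fin.sum_univ_two, Matrix.cons_val_zero, Matrix.cons_val_one, map_one, map_zero,
    one_smul, zero_smul, add_zero, zero_add] at h0 h1 h2
  have hm := Submodule.mem_span_singleton_self (R := L) (e' 0 + ζ' • e' 1)
  rw [← hΘ', hΘ] at hm
  obtain ⟨ρ, hρ⟩ := Submodule.mem_span_singleton.1 hm
  have coord : ∀ x y x' y' : L, x • e 0 + y • e 1 = x' • e 0 + y' • e 1 → x = x' ∧ y = y' := by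
    intro x y x' y' hxy
    have := he2 (x - x') (y - y') (by
      rw [sub_smul, sub_smul]
      rw [← sub_eq_zero] at hxy
      rw [← hxy]; abel)
    exact ⟨sub_eq_zero.1 this.1, sub_eq_zero.1 this.2⟩
  obtain ⟨A1, A2⟩ := coord (l * algebraMap F L a + m * algebraMap F L p)
    (l * algebraMap F L c + m * algebraMap F L r) _ _ (by
      rw [← h2, h0, h1, add_smul, add_smul]; abel)
  obtain ⟨B1, B2⟩ := coord (l * algebraMap F L a + ζ' * (m * algebraMap F L p))
    (l * algebraMap F L c + ζ' * (m * algebraMap F L r)) ρ (ρ * ζ) (by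
      have : ρ • e 0 + (ρ * ζ) • e 1 = e' 0 + ζ' • e' 1 := by
        rw [← hρ, smul_add, smul_smul]
      rw [this, h0, h1, add_smul, add_smul, smul_add, smul_smul, smul_smul]; abel)
  have hl : l ≠ 0 := by
    rintro rfl
    have := he' 1 0 (by simp [h0])
    simp at this
  have hm0 : m ≠ 0 := by
    rintro rfl
    have := he' 0 1 (by simp [h1])
    simp at this
  have hD : algebraMap F L a * algebraMap F L r - algebraMap F L c * algebraMap F L p ≠ 0 := by
    intro hD
    have e1 := he' (m * algebraMap F L p) (-(l * algebraMap F L a)) (by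
      rw [h0, h1]
      simp only [smul_add, smul_smul]
      have : m * algebraMap F L p * (l * algebraMap F L c) =
        - (-(l * algebraMap F L a) * (m * algebraMap F L r)) := by linear_combination (-m * l) * hD
      rw [this]
      have : m * algebraMap F L p * (l * algebraMap F L a) =
        - (-(l * algebraMap F L a) * (m * algebraMap F L p)) := by ring
      rw [this, neg_smul, neg_smul]; abel)
    have e2 := he' (m * algebraMap F L r) (-(l * algebraMap F L c)) (by
      rw [h0, h1]
      simp only [smul_add, smul_smul]
      have : m * algebraMap F L r * (l * algebraMap F L a) =
        - (-(l * algebraMap F L c) * (m * algebraMap F L p)) := by linear_combination (m * l) * hD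
      rw [this]
      have : m * algebraMap F L r * (l * algebraMap F L c) =
        - (-(l * algebraMap F L c) * (m * algebraMap F L r)) := by ring
      rw [this, neg_smul, neg_smul]; abel)
    have := he' 1 0 (by
      rw [h0, neg_eq_zero.1 e1.2, neg_eq_zero.1 e2.2]; simp)
    simp at this
  have M1 : l * (algebraMap F L a * algebraMap F L r - algebraMap F L c * algebraMap F L p) =
      v * algebraMap F L (s * r - t * p) := by
    simp only [map_sub, map_mul]
    linear_combination (algebraMap F L r) * A1 - (algebraMap F L p) * A2
  have M2 : m * (algebraMap F L a * algebraMap F L r - algebraMap F L c * algebraMap F L p) =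
      v * algebraMap F L (t * a - s * c) := by
    simp only [map_sub, map_mul]
    linear_combination (algebraMap F L a) * A2 - (algebraMap F L c) * A1
  have hv : v ≠ 0 := by
    rintro rfl
    rw [zero_mul] at M1
    exact (mul_ne_zero hl hD) M1
  have hu : algebraMap F L (t * a - s * c) ≠ 0 := by
    intro hu
    rw [hu, mul_zero] at M2
    exact (mul_ne_zero hm0 hD) M2
  have hz : algebraMap F L r - ζ * algebraMap F L p ≠ 0 := by
    intro hz
    have : l * (algebraMap F L c - ζ * algebraMap F L a) = 0 := by
      linear_combination B2 - ζ * B1 - ζ' * m * hz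
    rcases mul_eq_zero.1 this with h' | h'
    · exact hl h'
    · apply hD
      linear_combination (algebraMap F L a) * hz - (algebraMap F L p) * h'
  have main : ζ' = algebraMap F L (s * r - t * p) * (ζ * algebraMap F L a - algebraMap F L c) /
      (algebraMap F L (t * a - s * c) * (algebraMap F L r - ζ * algebraMap F L p)) := by
    rw [eq_div_iff (mul_ne_zero hu hz)]
    apply mul_left_cancel₀ hv
    linear_combination (- ζ' * (algebraMap F L r - ζ * algebraMap F L p)) * M2 +
      (- (ζ * algebraMap F L a - algebraMap F L c)) * (-M1) +
      (algebraMap F L a * algebraMap F L r - algebraMap F L c * algebraMap F L p) * (B2 - ζ * B1)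
  have hζ : ζ ∈ IntermediateField.adjoin F {ζ} := IntermediateField.mem_adjoin_simple_self F ζ
  have hF : ∀ x : F, algebraMap F L x ∈ IntermediateField.adjoin F {ζ} :=
    fun x => IntermediateField.algebraMap_mem _ x
  rw [main]
  exact div_mem (mul_mem (hF _) (sub_mem (mul_mem hζ (hF _)) (hF _)))
    (mul_mem (hF _) (sub_mem (hF _) (mul_mem hζ (hF _))))

/-- The degree does not depend on the frame. -/
theorem pointDegree_eq {F L V : Type*} [Field F] [Field L] [Algebra F L]
    [AddCommGroup V] [Module L V] {Θ : ℙ L V} {b : Set (ℙ L V)} {e : Fin 2 → V} {ζ : L}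
    (he : LinearIndependent L e) (hb : b = rationalPoints F e)
    (hΘ : Θ.submodule = Submodule.span L {e 0 + ζ • e 1}) :
    pointDegree F Θ b = Module.finrank F (IntermediateField.adjoin F {ζ}) := by
  have hmem := Nat.sInf_mem (s := {m | ∃ (e : Fin 2 → V) (ζ : L), LinearIndependent L e ∧
    b = rationalPoints F e ∧ Θ.submodule = Submodule.span L {e 0 + ζ • e 1} ∧
    m = Module.finrank F (IntermediateField.adjoin F {ζ})}) ⟨_, e, ζ, he, hb, hΘ, rfl⟩
  obtain ⟨e', ζ', he', hb', hΘ', hm⟩ := hmem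
  have heq : IntermediateField.adjoin F {ζ'} = IntermediateField.adjoin F {ζ} := by
    apply le_antisymm
    · rw [IntermediateField.adjoin_simple_le_iff]
      exact mem_adjoin_of_frames he he' (hb.symm.trans hb') hΘ hΘ'
    · rw [IntermediateField.adjoin_simple_le_iff]
      exact mem_adjoin_of_frames he' he (hb'.symm.trans hb) hΘ' hΘ
  rw [← heq, ← hm]
  rfl

/-- The representation of a point off the line at infinity is a single point. -/
theorem existsUnique_mem_abbPoint {F L : Type*} [Field F] [Field L] [Algebra F L]
    [FiniteDimensional F L] (linf : Projectivization.Subspace L (Fin 3 → L))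
    (hlinf : Module.finrank L linf.submodule = 2)
    (K : Projectivization.Subspace F (Fin 3 → L))
    (hK : Module.finrank F K.submodule = 2 * Module.finrank F L + 1)
    (hlK : ∀ X ∈ linf, fieldReduction F X ≤ K) (X : ℙ L (Fin 3 → L)) (hX : X ∉ linf) :
    ∃! P, P ∈ abbPoint K X := by
  set l : Submodule F (Fin 3 → L) := linf.submodule.restrictScalars F with hl
  set x : Submodule F (Fin 3 → L) := X.submodule.restrictScalars F with hx
  set k : Submodule F (Fin 3 → L) := K.submodule with hk
  have hlk : l ≤ k := by
    intro v hv
    by_cases hv0 : v = 0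
    · rw [hv0]; exact k.zero_mem
    have h1 : Projectivization.mk L v hv0 ∈ linf :=
      (Projectivization.Subspace.mem_submodule_iff linf hv0).1 hv
    refine (Projectivization.Subspace.mem_submodule_iff K hv0).2 (hlK _ h1 ?_)
    exact (Submodule.mk_mem_projectivization_iff _ hv0).2 (Submodule.mem_span_singleton_self v)
  have hxl : x ⊓ l = ⊥ := by
    rw [eq_bot_iff]
    rintro v ⟨h1, h2⟩
    by_contra hv0'
    have hv0 : v ≠ 0 := fun h => hv0' (by simp [h])
    apply hX
    have h3 : Projectivization.mk L v hv0 ∈ linf :=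
      (Projectivization.Subspace.mem_submodule_iff linf hv0).1 h2
    have : Projectivization.mk L v hv0 = X := by
      rw [← Projectivization.mk_rep X, Projectivization.mk_eq_mk_iff']
      have h1' : v ∈ X.submodule := h1
      rw [Projectivization.submodule_eq] at h1'
      exact Submodule.mem_span_singleton.1 h1'
    rwa [this] at h3
  have fl : Module.finrank F l = Module.finrank F L * 2 := by
    rw [← hlinf]
    exact (Module.finrank_mul_finrank F L linf.submodule).symm
  have fx : Module.finrank F x = Module.finrank F L * 1 := by
    rw [← Projectivization.finrank_submodule X]
    exact (Module.finrank_mul_finrank F L X.submodule).symm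
  have fV : Module.finrank F (Fin 3 → L) = Module.finrank F L * 3 := by
    rw [← Module.finrank_mul_finrank F L (Fin 3 → L)]; simp
  have f1 := Submodule.finrank_sup_add_finrank_inf_eq x k
  have f2 := Submodule.finrank_sup_add_finrank_inf_eq (x ⊓ k) l
  have f3 : Module.finrank F ↥(x ⊔ k) ≤ Module.finrank F L * 3 := fV ▸ Submodule.finrank_le _
  have f4 : Module.finrank F ↥(x ⊓ k ⊔ l) ≤ Module.finrank F k :=
    Submodule.finrank_mono (sup_le inf_le_right hlk)
  have f5 : x ⊓ k ⊓ l = ⊥ := by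
    rw [eq_bot_iff, ← hxl]; exact inf_le_inf_right _ inf_le_left
  rw [f5, finrank_bot] at f2
  have f6 : Module.finrank F ↥(x ⊓ k) = 1 := by omega
  have hmem : ∀ P : ℙ F (Fin 3 → L), P ∈ abbPoint K X ↔ P.submodule ≤ x ⊓ k := by
    intro P
    rw [le_inf_iff, ← Submodule.mem_projectivization_iff_submodule_le,
      ← Submodule.mem_projectivization_iff_submodule_le]
    simp [hk, hx, abbPoint, fieldReduction]
  refine ⟨Projectivization.mk'' _ f6, ?_, ?_⟩
  · dsimp only
    rw [hmem, Projectivization.submodule_mk'']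
  · intro P hP
    rw [hmem] at hP
    apply Projectivization.submodule_injective
    rw [Projectivization.submodule_mk'']
    exact Submodule.eq_of_le_of_finrank_eq hP (by rw [f6, Projectivization.finrank_submodule])

/-! Some `L`-linear functional `f` vanishes exactly on the line at infinity and has `K` as the
preimage of `F`. Hence `φ(Lx)` is spanned by `x / f x`, and `φ` amounts to division by `f`. Take a
frame `e 0`, `e 1`, `t` of `B`, with `b` spanned by the first two vectors and `T` by `t`. Rescaling
`f` by `f (e 1)`, its value at `s e 0 + u e 1` is the linear form `u - s ζ`, where `e 0 + ζ e 1`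
spans `Θ`. A point `s e 0 + u e 1 + d t` of `B` is therefore sent to `y₀ + d y₁`, where `y₀ = (s e 0
+ u e 1) / f` and `y₁ = t / f` depend only on `(s, u)`. For fixed `(s, u)` and `d` running over `F`
these are the affine points of the line joining `y₀` to `y₁`, so the ruled surface appears with the
projectivity given by equal parameters.

It remains to see that `y₀` and `y₁` trace normal rational curves. Let `m + 1` be the degree of `ζ`,
`p` its minimal polynomial and `r = p / (X - ζ)`, with homogenizations of degrees `m + 1` and `m`.
Then `1 / (u - s ζ) = r(s, u) / p(s, u)`; the denominator lies in `F` and is projectively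
irrelevant, and the coefficients of `r` form an `F`-basis of `F(ζ)`. So `y₁` has order `m`. Since
`y₀ = a + (s / (u - s ζ)) w`, with `a` and `w` independent over `L`, clearing the denominator gives
order `m + 1`. This is used when `m + 1 ≤ q`.

If `m + 1 > q`, the `q + 1` values of `1 / (u - s ζ)` are independent over `F` by a partial fraction
argument. Any `q + 1` independent points form a normal rational curve of order `q`, by inverting a
Vandermonde matrix, and both curves have order `q`. -/

/-! ### Dividing the minimal polynomial by `X - ζ`. -/

open Polynomial in
theorem linearIndependent_coeff_minpolyDiv {F L : Type*} [Field F] [Field L] [Algebra F L]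
    {ζ : L} (hζ : IsIntegral F ζ) :
    LinearIndependent F (fun i : Fin (minpoly F ζ).natDegree => (minpolyDiv F ζ).coeff i) := by
  rw [linearIndependent_iff_card_eq_finrank_span, Set.finrank]
  -- The coefficients span `F[ζ]`, whose dimension equals their number.
  have hs : Submodule.span F (Set.range fun i : Fin (minpoly F ζ).natDegree =>
      (minpolyDiv F ζ).coeff i) = Subalgebra.toSubmodule (Algebra.adjoin F {ζ}) := by
    rw [← span_coeff_minpolyDiv hζ]
    apply le_antisymm
    · apply Submodule.span_mono
      rintro _ ⟨i, rfl⟩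
      exact ⟨i, rfl⟩
    · rw [Submodule.span_le]
      rintro _ ⟨i, rfl⟩
      by_cases hi : i < (minpoly F ζ).natDegree
      · exact Submodule.subset_span ⟨⟨i, hi⟩, rfl⟩
      · have : (minpolyDiv F ζ).coeff i = 0 := by
          apply coeff_eq_zero_of_natDegree_lt
          have := natDegree_minpolyDiv_lt hζ
          omega
        simp [this]
  rw [hs, Fintype.card_fin, ← IntermediateField.adjoin.finrank hζ,
    ← IntermediateField.adjoin_simple_toSubalgebra_of_isAlgebraic hζ.isAlgebraic]
  rfl

/-- Multiplying a binary form by the linear form `t - s ζ`. -/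
theorem binaryForm_mul_linear {R : Type*} [CommRing R] (r p : ℕ → R) (ζ s t : R) (m : ℕ)
    (hr : r (m + 1) = 0) (h0 : p 0 = - (r 0 * ζ)) (hp : ∀ i, p (i + 1) = r i - r (i + 1) * ζ) :
    (∑ i ∈ Finset.range (m + 1), s ^ (m - i) * t ^ i * r i) * (t - s * ζ) =
      ∑ i ∈ Finset.range (m + 2), s ^ (m + 1 - i) * t ^ i * p i := by
  have h1 : ∑ i ∈ Finset.range (m + 2), s ^ (m + 1 - i) * t ^ i * r i =
      (∑ i ∈ Finset.range (m + 1), s ^ (m - i) * t ^ i * r i) * s := by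
    rw [Finset.sum_range_succ, hr, mul_zero, add_zero, Finset.sum_mul]
    refine Finset.sum_congr rfl fun i hi => ?_
    have : m + 1 - i = (m - i) + 1 := by have := Finset.mem_range.1 hi; omega
    rw [this]; ring
  have h2 : ∑ i ∈ Finset.range (m + 2), s ^ (m + 1 - i) * t ^ i * p i =
      (∑ i ∈ Finset.range (m + 1), s ^ (m - i) * t ^ i * r i) * t -
        (∑ i ∈ Finset.range (m + 2), s ^ (m + 1 - i) * t ^ i * r i) * ζ := by
    rw [Finset.sum_range_succ', Finset.sum_range_succ' (n := m + 1), h0, add_mul, Finset.sum_mul,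
      Finset.sum_mul, ← sub_sub, ← Finset.sum_sub_distrib, sub_eq_add_neg]
    congr 1
    · refine Finset.sum_congr rfl fun i _ => ?_
      rw [hp, Nat.add_sub_add_right]; ring
    · simp [mul_assoc]
  rw [h2, h1]; ring

theorem sub_mul_ne_zero_of_notMem_range {F L : Type*} [Field F] [Field L] [Algebra F L] {ζ : L}
    (hζ : ζ ∉ Set.range (algebraMap F L)) {v : Fin 2 → F} (hv : v ≠ 0) :
    algebraMap F L (v 1) - algebraMap F L (v 0) * ζ ≠ 0 := by
  intro h
  by_cases h0 : v 0 = 0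
  · apply hv
    rw [h0, map_zero, zero_mul, sub_zero, map_eq_zero] at h
    ext i; fin_cases i <;> assumption
  · apply hζ
    refine ⟨v 1 / v 0, ?_⟩
    have : algebraMap F L (v 0) ≠ 0 := by simpa using h0
    rw [map_div₀, div_eq_iff this]
    linear_combination h

/-- The map on points induced by a map of vectors. -/
noncomputable def curve {F V : Type*} [Field F] [AddCommGroup V] [Module F V]
    (y : (Fin 2 → F) → V) (h0 : ∀ v, v ≠ 0 → y v ≠ 0) (p : ℙ F (Fin 2 → F)) : ℙ F V :=
  Projectivization.mk F (y p.rep) (h0 _ p.rep_nonzero)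

/-! ### Recognizing normal rational curves. -/

section curve

variable {F V : Type*} [Field F] [AddCommGroup V] [Module F V] {y : (Fin 2 → F) → V}

theorem curve_mk (h0 : ∀ v, v ≠ 0 → y v ≠ 0)
    (hy : ∀ c : F, c ≠ 0 → ∀ v, ∃ c' : F, y (c • v) = c' • y v) {v : Fin 2 → F} (hv : v ≠ 0) :
    curve y h0 (Projectivization.mk F v hv) = Projectivization.mk F (y v) (h0 v hv) := by
  obtain ⟨c, hc⟩ := Projectivization.exists_smul_eq_mk_rep F v hv
  obtain ⟨c', hc'⟩ := hy c c.ne_zero v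
  rw [curve, Projectivization.mk_eq_mk_iff']
  exact ⟨c', by rw [← hc', ← hc]; rfl⟩

/-- The factor `N` may vary with `v`, because only the spanned point matters: this is where
denominators get cleared. -/
theorem isNRCParametrization_of_forms (h0 : ∀ v, v ≠ 0 → y v ≠ 0)
    (hy : ∀ c : F, c ≠ 0 → ∀ v, ∃ c' : F, y (c • v) = c' • y v) {δ : ℕ} {c : Fin (δ + 1) → V}
    (hc : LinearIndependent F c)
    (h : ∀ v : Fin 2 → F, v ≠ 0 → ∃ N : F, N ≠ 0 ∧
      ∑ i : Fin (δ + 1), (v 0 ^ (δ - (i : ℕ)) * v 1 ^ (i : ℕ)) • c i = N • y v) :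
    IsNRCParametrization δ (curve y h0) := by
  refine ⟨c, hc, fun v hv => ?_⟩
  obtain ⟨N, hN, h⟩ := h v hv
  rw [curve_mk h0 hy hv, h, Projectivization.submodule_mk]
  exact (Submodule.span_singleton_smul_eq (IsUnit.mk0 N hN) _).symm

/-- Nonproportionality of distinct points of the projective line. -/
theorem rep_cross_ne_zero {p p' : ℙ F (Fin 2 → F)} (h : p ≠ p') :
    p.rep 1 * p'.rep 0 - p'.rep 1 * p.rep 0 ≠ 0 := by
  intro h0
  apply h
  rw [← p.mk_rep, ← p'.mk_rep, Projectivization.mk_eq_mk_iff']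
  have hp' := p'.rep_nonzero
  by_cases h1 : p'.rep 0 = 0
  · have h2 : p'.rep 1 ≠ 0 := fun h2 => hp' (by ext i; fin_cases i <;> assumption)
    refine ⟨p.rep 1 / p'.rep 1, ?_⟩
    have h3 : p.rep 0 = 0 := by simpa [h1, h2] using h0
    ext i; fin_cases i
    · simp [h1, h3]
    · simp [h2]
  · refine ⟨p.rep 0 / p'.rep 0, ?_⟩
    ext i; fin_cases i
    · simp [h1]
    · simp only [Pi.smul_apply, smul_eq_mul, Fin.mk_one]
      rw [div_mul_eq_mul_div, div_eq_iff h1]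
      linear_combination -h0

/-- Any `q + 1` independent points form a normal rational curve of order `q`. -/
theorem isNRCParametrization_of_linearIndependent [Finite F] (h0 : ∀ v, v ≠ 0 → y v ≠ 0)
    (hli : LinearIndependent F fun p : ℙ F (Fin 2 → F) => y p.rep) :
    IsNRCParametrization (Nat.card F) (curve y h0) := by
  have hcard := Projectivization.card_of_finrank_two F (Fin 2 → F) (by simp)
  have : Finite (ℙ F (Fin 2 → F)) := inferInstance
  let e : Fin (Nat.card F + 1) ≃ ℙ F (Fin 2 → F) := (Finite.equivFinOfCardEq hcard).symm
  set A := Matrix.projVandermonde (fun i => (e i).rep 1) (fun i => (e i).rep 0) with hA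
  have hdet : IsUnit A.det := by
    rw [isUnit_iff_ne_zero, hA, Matrix.det_projVandermonde, Finset.prod_ne_zero_iff]
    intro i _
    rw [Finset.prod_ne_zero_iff]
    intro j hj
    apply rep_cross_ne_zero
    exact fun h => (Finset.mem_Ioi.1 hj).ne' (e.injective h)
  have hli' : LinearIndependent F fun i => y (e i).rep := hli.comp e e.injective
  have key : ∀ i, ∑ j, A i j • ∑ k, A⁻¹ j k • y (e k).rep = y (e i).rep := by
    intro i
    simp_rw [Finset.smul_sum, smul_smul]
    rw [Finset.sum_comm]
    simp_rw [← Finset.sum_smul]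
    have : ∀ k, ∑ j, A i j * A⁻¹ j k = (1 : Matrix _ _ F) i k := by
      intro k
      rw [← Matrix.mul_nonsing_inv A hdet, Matrix.mul_apply]
    simp [this, Matrix.one_apply]
  refine ⟨fun j => ∑ k, A⁻¹ j k • y (e k).rep, ?_, fun v hv => ?_⟩
  · rw [Fintype.linearIndependent_iff] at hli' ⊢
    intro g hg
    have h1 : ∀ k, Matrix.vecMul g A⁻¹ k = 0 := by
      apply hli'
      rw [← hg]
      simp_rw [Matrix.vecMul, dotProduct, Finset.sum_smul, Finset.smul_sum, smul_smul]
      rw [Finset.sum_comm]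
    have h2 : Matrix.vecMul (Matrix.vecMul g A⁻¹) A = 0 := by
      rw [show Matrix.vecMul g A⁻¹ = 0 from funext h1, Matrix.zero_vecMul]
    rw [Matrix.vecMul_vecMul, Matrix.nonsing_inv_mul A hdet, Matrix.vecMul_one] at h2
    exact congrFun h2
  · obtain ⟨c, hc⟩ := Projectivization.exists_smul_eq_mk_rep F v hv
    obtain ⟨i, hi⟩ := e.surjective (Projectivization.mk F v hv)
    have hk := key i
    rw [hi] at hk
    -- Replacing `v` by its representative multiplies every monomial by the same `c ^ q`.
    have hs : ∑ j, A i j • ∑ k, A⁻¹ j k • y (e k).rep = ((c : F) ^ Nat.card F) •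
        ∑ j : Fin (Nat.card F + 1), (v 0 ^ (Nat.card F - (j : ℕ)) * v 1 ^ (j : ℕ)) •
          ∑ k, A⁻¹ j k • y (e k).rep := by
      rw [Finset.smul_sum]
      refine Finset.sum_congr rfl fun j _ => ?_
      rw [smul_smul]
      congr 1
      rw [hA, Matrix.projVandermonde_apply, hi, ← hc, Fin.val_rev]
      simp only [Units.smul_def, Pi.smul_apply, smul_eq_mul, mul_pow]
      have : (c : F) ^ Nat.card F = (c : F) ^ (j : ℕ) * (c : F) ^ (Nat.card F - (j : ℕ)) := by
        rw [← pow_add]; congr 1; omega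
      rw [this]
      have : Nat.card F + 1 - (j + 1) = Nat.card F - (j : ℕ) := by omega
      simp only [this]
      ring
    have hc0 : IsUnit ((c : F) ^ Nat.card F) := (c.isUnit).pow _
    rw [curve, Projectivization.submodule_mk, ← hk, hs]
    exact Submodule.span_singleton_smul_eq hc0 _

end curve

/-! ### The linear form `t - s ζ`, its multiple over `F`, and its inverses. -/

section forms

variable {F L : Type*} [Field F] [Field L] [Algebra F L]

/-- The linear form `t - s ζ` on `F²`. -/
def poleForm (F : Type*) {L : Type*} [Field F] [Field L] [Algebra F L] (ζ : L) (v : Fin 2 → F) :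
    L :=
  algebraMap F L (v 1) - algebraMap F L (v 0) * ζ

theorem poleForm_smul (ζ : L) (c : F) (v : Fin 2 → F) :
    poleForm F ζ (c • v) = algebraMap F L c * poleForm F ζ v := by
  simp [poleForm]; ring

/-- The homogenization of the minimal polynomial of `ζ`. -/
noncomputable def normForm (F : Type*) {L : Type*} [Field F] [Field L] [Algebra F L] (ζ : L)
    (v : Fin 2 → F) : F :=
  ∑ i ∈ Finset.range ((minpoly F ζ).natDegree + 1),
    v 0 ^ ((minpoly F ζ).natDegree - i) * v 1 ^ i * (minpoly F ζ).coeff i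

theorem coeff_minpolyDiv_natDegree {ζ : L} (hζ : IsIntegral F ζ) :
    (minpolyDiv F ζ).coeff (minpoly F ζ).natDegree = 0 :=
  Polynomial.coeff_eq_zero_of_natDegree_lt (natDegree_minpolyDiv_lt hζ)

theorem coeff_zero_minpoly (ζ : L) :
    algebraMap F L ((minpoly F ζ).coeff 0) = - ((minpolyDiv F ζ).coeff 0 * ζ) := by
  rw [← Polynomial.coeff_map, ← minpolyDiv_spec F ζ]; simp [mul_sub]

theorem coeff_succ_minpoly (ζ : L) (i : ℕ) :
    algebraMap F L ((minpoly F ζ).coeff (i + 1)) =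
      (minpolyDiv F ζ).coeff i - (minpolyDiv F ζ).coeff (i + 1) * ζ := by
  rw [coeff_minpolyDiv F ζ i]; ring

/-- The homogenization of `minpolyDiv * (X - ζ) = minpoly`. It expresses `1 / (t - s ζ)`, up to a
scalar of `F`, by binary forms in a basis of `F(ζ)`. -/
theorem sum_minpolyDiv_mul_poleForm {ζ : L} (hζ : IsIntegral F ζ) {m : ℕ}
    (hm : (minpoly F ζ).natDegree = m + 1) (v : Fin 2 → F) :
    (∑ i ∈ Finset.range (m + 1), algebraMap F L (v 0 ^ (m - i) * v 1 ^ i) *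
      (minpolyDiv F ζ).coeff i) * poleForm F ζ v = algebraMap F L (normForm F ζ v) := by
  have h := binaryForm_mul_linear (fun i => (minpolyDiv F ζ).coeff i)
    (fun i => algebraMap F L ((minpoly F ζ).coeff i)) ζ (algebraMap F L (v 0))
    (algebraMap F L (v 1)) m (hm ▸ coeff_minpolyDiv_natDegree hζ) (coeff_zero_minpoly ζ)
    (coeff_succ_minpoly ζ)
  simp only [poleForm, normForm, hm, map_sum, map_mul, map_pow]
  exact h

/-- If it vanished, so would the cofactor of `t - s ζ`. Its coordinates in the basis given by
`minpolyDiv` include `s ^ m` and `t ^ m`, forcing `v = 0`. -/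
theorem normForm_ne_zero {ζ : L} (hζ : IsIntegral F ζ) (hζF : ζ ∉ Set.range (algebraMap F L))
    {v : Fin 2 → F} (hv : v ≠ 0) : normForm F ζ v ≠ 0 := by
  intro h0
  obtain ⟨m, hm⟩ : ∃ m, (minpoly F ζ).natDegree = m + 1 :=
    Nat.exists_eq_succ_of_ne_zero (minpoly.natDegree_pos hζ).ne'
  have h := sum_minpolyDiv_mul_poleForm hζ hm v
  rw [h0, map_zero] at h
  replace h := (mul_eq_zero.1 h).resolve_right (sub_mul_ne_zero_of_notMem_range hζF hv)
  have hli := linearIndependent_coeff_minpolyDiv hζ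
  rw [hm, Fintype.linearIndependent_iff] at hli
  have hz := hli (fun i => v 0 ^ (m - (i : ℕ)) * v 1 ^ (i : ℕ)) (by
    rw [← h, Finset.sum_range]
    exact Finset.sum_congr rfl fun i _ => Algebra.smul_def _ _)
  have z0 := hz 0
  have z1 := hz (Fin.last m)
  simp only [Fin.val_zero, Nat.sub_zero, pow_zero, mul_one, Fin.val_last, Nat.sub_self,
    one_mul] at z0 z1
  exact hv (by ext i; fin_cases i; exacts [eq_zero_of_pow_eq_zero z0, eq_zero_of_pow_eq_zero z1])

open Polynomial in
/-- The functions `1 / (t - s ζ)` on the projective line are independent if the degree of `ζ`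
exceeds the order of `F`. -/
theorem linearIndependent_inv_poleForm [Finite F] {ζ : L}
    (hq : Nat.card F < (minpoly F ζ).natDegree) (hζF : ζ ∉ Set.range (algebraMap F L)) :
    LinearIndependent F fun p : ℙ F (Fin 2 → F) => (poleForm F ζ p.rep)⁻¹ := by
  classical
  have : Finite (ℙ F (Fin 2 → F)) := inferInstance
  have : Fintype (ℙ F (Fin 2 → F)) := Fintype.ofFinite _
  have hcard : Fintype.card (ℙ F (Fin 2 → F)) = Nat.card F + 1 := by
    rw [← Nat.card_eq_fintype_card]
    exact Projectivization.card_of_finrank_two F (Fin 2 → F) (by simp)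
  rw [Fintype.linearIndependent_iff]
  intro g hg
  have hne : ∀ p : ℙ F (Fin 2 → F), poleForm F ζ p.rep ≠ 0 := fun p =>
    sub_mul_ne_zero_of_notMem_range hζF p.rep_nonzero
  let l : ℙ F (Fin 2 → F) → F[X] := fun p => C (p.rep 1) - C (p.rep 0) * X
  have hl : ∀ p, aeval ζ (l p) = poleForm F ζ p.rep := fun p => by simp [l, poleForm]
  -- The linear relation multiplied by all the linear forms, with `ζ` replaced by `X`. Its degree is
  -- at most `q`, less than that of `ζ`, so it vanishes identically.
  let Q : F[X] := ∑ p, C (g p) * ∏ p' ∈ Finset.univ.erase p, l p'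
  have hQ0 : aeval ζ Q = 0 := by
    have : aeval ζ Q = (∏ p : ℙ F (Fin 2 → F), poleForm F ζ p.rep) *
        ∑ p, g p • (poleForm F ζ p.rep)⁻¹ := by
      simp only [Q, map_sum, map_mul, map_prod, hl, aeval_C, Finset.mul_sum]
      refine Finset.sum_congr rfl fun p _ => ?_
      rw [← Finset.mul_prod_erase _ _ (Finset.mem_univ p), Algebra.smul_def]
      field_simp [hne p]
    rw [this, hg, mul_zero]
  have hdeg : Q.natDegree ≤ Nat.card F := by
    refine natDegree_sum_le_of_forall_le _ _ fun p _ => ?_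
    refine (natDegree_C_mul_le _ _).trans ((natDegree_prod_le _ _).trans ?_)
    refine (Finset.sum_le_card_nsmul _ _ 1 fun p' _ => ?_).trans ?_
    · refine (natDegree_sub_le _ _).trans (max_le (by simp) ?_)
      exact (natDegree_C_mul_le _ _).trans natDegree_X_le
    · rw [Finset.card_erase_of_mem (Finset.mem_univ _), Finset.card_univ, hcard]; simp
  have hQ : Q = 0 := by
    by_contra hQ
    have := natDegree_le_of_dvd (minpoly.dvd F ζ hQ0) hQ
    omega
  -- Evaluation at the root of `l p` kills every term of `Q` except the one of index `p`.
  have hfin : ∀ p : ℙ F (Fin 2 → F), p.rep 0 ≠ 0 → g p = 0 := by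
    intro p hp
    have hev : ∀ p', eval (p.rep 1 / p.rep 0) (l p') =
        (p'.rep 1 * p.rep 0 - p.rep 1 * p'.rep 0) / p.rep 0 := by
      intro p'; simp only [l, eval_sub, eval_mul, eval_C, eval_X]; field_simp
    have h := congrArg (eval (p.rep 1 / p.rep 0)) hQ
    simp only [Q, eval_finsetSum, eval_mul, eval_C, eval_prod, eval_zero] at h
    rw [Finset.sum_eq_single p] at h
    · refine (mul_eq_zero.1 h).resolve_right (Finset.prod_ne_zero_iff.2 fun p' hp' => ?_)
      rw [hev]
      exact div_ne_zero (rep_cross_ne_zero (Finset.ne_of_mem_erase hp')) hp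
    · intro p' _ hp'
      rw [Finset.prod_eq_zero (i := p) (by simp [hp'.symm]), mul_zero]
      rw [hev]; simp [mul_comm]
    · simp
  intro p
  -- At the point at infinity `l p` is constant and has no root, but its term is the only one left
  -- in the original relation.
  by_cases hp : p.rep 0 = 0
  · rw [Finset.sum_eq_single p] at hg
    · exact (smul_eq_zero.1 hg).resolve_right (inv_ne_zero (hne p))
    · intro p' _ hp'
      rw [hfin p', zero_smul]
      intro h0
      exact rep_cross_ne_zero hp' (by simp [hp, h0])
    · simp
  · exact hfin p hp

end forms

/-! ### The curves traced on `T` and on `⟨b⟩`, for small and for large degree of `ζ`. -/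

section curves

variable {F L V : Type*} [Field F] [Field L] [Algebra F L] [AddCommGroup V] [Module F V]
  [Module L V] [IsScalarTower F L V]

theorem isNRCParametrization_inv_poleForm {ζ : L} (hζ : IsIntegral F ζ)
    (hζF : ζ ∉ Set.range (algebraMap F L)) {τ : V} (hτ : τ ≠ 0) {y : (Fin 2 → F) → V}
    (hy : ∀ v, v ≠ 0 → y v = (poleForm F ζ v)⁻¹ • τ) (h0 : ∀ v, v ≠ 0 → y v ≠ 0)
    (hs : ∀ c : F, c ≠ 0 → ∀ v, ∃ c' : F, y (c • v) = c' • y v) :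
    IsNRCParametrization ((minpoly F ζ).natDegree - 1) (curve y h0) := by
  obtain ⟨m, hm⟩ : ∃ m, (minpoly F ζ).natDegree = m + 1 :=
    Nat.exists_eq_succ_of_ne_zero (minpoly.natDegree_pos hζ).ne'
  have hli := linearIndependent_coeff_minpolyDiv hζ
  rw [hm] at hli ⊢
  refine isNRCParametrization_of_forms h0 hs
    (c := fun i : Fin (m + 1) => (minpolyDiv F ζ).coeff i • τ) ?_ fun v hv =>
      ⟨normForm F ζ v, normForm_ne_zero hζ hζF hv, ?_⟩
  · rw [Fintype.linearIndependent_iff] at hli ⊢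
    intro g hg
    apply hli
    simp_rw [← smul_assoc, ← Finset.sum_smul] at hg
    exact (smul_eq_zero.1 hg).resolve_right hτ
  · have h := sum_minpolyDiv_mul_poleForm hζ hm v
    have hne : poleForm F ζ v ≠ 0 := sub_mul_ne_zero_of_notMem_range hζF hv
    rw [hy v hv, ← algebraMap_smul L (normForm F ζ v), smul_smul, ← h, mul_assoc,
      mul_inv_cancel₀ hne, mul_one, Finset.sum_range, Finset.sum_smul]
    refine Finset.sum_congr rfl fun i _ => ?_
    rw [← algebraMap_smul L (_ * _ : F), smul_smul]; rfl

theorem isNRCParametrization_inv_poleForm_of_lt [Finite F] {ζ : L}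
    (hζF : ζ ∉ Set.range (algebraMap F L)) (hq : Nat.card F < (minpoly F ζ).natDegree) {τ : V}
    (hτ : τ ≠ 0) {y : (Fin 2 → F) → V}
    (hy : ∀ v, v ≠ 0 → y v = (poleForm F ζ v)⁻¹ • τ) (h0 : ∀ v, v ≠ 0 → y v ≠ 0) :
    IsNRCParametrization (Nat.card F) (curve y h0) := by
  apply isNRCParametrization_of_linearIndependent h0
  have : Fintype (ℙ F (Fin 2 → F)) := Fintype.ofFinite _
  have hli := linearIndependent_inv_poleForm hq hζF
  rw [Fintype.linearIndependent_iff] at hli ⊢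
  intro g hg
  apply hli
  simp_rw [hy _ (Projectivization.rep_nonzero _), ← smul_assoc, ← Finset.sum_smul] at hg
  exact (smul_eq_zero.1 hg).resolve_right hτ

theorem isNRCParametrization_add_div_poleForm {ζ : L} (hζ : IsIntegral F ζ)
    (hζF : ζ ∉ Set.range (algebraMap F L)) {a w : V}
    (haw : ∀ x y : L, x • a + y • w = 0 → x = 0 ∧ y = 0) {y : (Fin 2 → F) → V}
    (hy : ∀ v, v ≠ 0 → y v = a + (algebraMap F L (v 0) / poleForm F ζ v) • w)
    (h0 : ∀ v, v ≠ 0 → y v ≠ 0)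
    (hs : ∀ c : F, c ≠ 0 → ∀ v, ∃ c' : F, y (c • v) = c' • y v) :
    IsNRCParametrization (minpoly F ζ).natDegree (curve y h0) := by
  obtain ⟨m, hm⟩ : ∃ m, (minpoly F ζ).natDegree = m + 1 :=
    Nat.exists_eq_succ_of_ne_zero (minpoly.natDegree_pos hζ).ne'
  have hli := linearIndependent_coeff_minpolyDiv hζ
  have hr := coeff_minpolyDiv_natDegree hζ
  have hlead : (minpoly F ζ).coeff (minpoly F ζ).natDegree = 1 := minpoly.monic hζ
  refine isNRCParametrization_of_forms h0 hs
    (c := fun i => algebraMap F L ((minpoly F ζ).coeff i) • a + (minpolyDiv F ζ).coeff i • w)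
    ?_ fun v hv => ⟨normForm F ζ v, normForm_ne_zero hζ hζF hv, ?_⟩
  · rw [Fintype.linearIndependent_iff] at hli ⊢
    intro g hg
    have hg' : (∑ i, algebraMap F L (g i) * algebraMap F L ((minpoly F ζ).coeff i)) • a +
        (∑ i, algebraMap F L (g i) * (minpolyDiv F ζ).coeff i) • w = 0 := by
      rw [← hg, Finset.sum_smul, Finset.sum_smul, ← Finset.sum_add_distrib]
      refine Finset.sum_congr rfl fun i _ => ?_
      rw [← algebraMap_smul L (g i), smul_add, smul_smul, smul_smul]
    obtain ⟨h1, h2⟩ := haw _ _ hg'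
    -- The `w`-component involves all but the last vector, since `minpolyDiv` has smaller degree; it
    -- kills those coefficients. The last one is then read off the `a`-component, `minpoly` being
    -- monic.
    rw [Fin.sum_univ_castSucc] at h1 h2
    simp only [Fin.val_castSucc, Fin.val_last, hr, mul_zero, add_zero, hlead, map_one,
      mul_one] at h1 h2
    have h3 := hli (fun i => g i.castSucc) (by
      rw [← h2]; exact Finset.sum_congr rfl fun i _ => Algebra.smul_def _ _)
    simp only [h3, map_zero, zero_mul, Finset.sum_const_zero, zero_add, map_eq_zero] at h1
    intro i
    induction i using Fin.lastCases with
    | last => exact h1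
    | cast i => exact h3 i
  · have h := sum_minpolyDiv_mul_poleForm hζ hm v
    have hne : poleForm F ζ v ≠ 0 := sub_mul_ne_zero_of_notMem_range hζF hv
    -- Multiplying the form of degree `m` by `s` raises its degree to `m + 1` without a new
    -- monomial, the added top coefficient being zero.
    have hsum : ∑ i ∈ Finset.range ((minpoly F ζ).natDegree + 1),
        algebraMap F L (v 0 ^ ((minpoly F ζ).natDegree - i) * v 1 ^ i) *
          (minpolyDiv F ζ).coeff i =
        algebraMap F L (normForm F ζ v) * (algebraMap F L (v 0) / poleForm F ζ v) := by
      rw [← h, mul_assoc, mul_div_cancel₀ _ hne, Finset.sum_range_succ, hr, mul_zero, add_zero,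
        hm, Finset.sum_mul]
      refine Finset.sum_congr rfl fun i hi => ?_
      have : m + 1 - i = (m - i) + 1 := by have := Finset.mem_range.1 hi; omega
      simp only [this, map_mul, map_pow]; ring
    rw [hy v hv, smul_add, ← algebraMap_smul L (normForm F ζ v),
      ← algebraMap_smul L (normForm F ζ v), smul_smul, ← hsum, normForm,
      Finset.sum_range, Finset.sum_range, Finset.sum_smul, map_sum, Finset.sum_smul, ← Finset.sum_add_distrib]
    refine Finset.sum_congr rfl fun i _ => ?_
    rw [← algebraMap_smul L (_ * _ : F), smul_add, smul_smul, smul_smul, map_mul _ (_ * _)]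

theorem isNRCParametrization_add_div_poleForm_of_lt [Finite F] {ζ : L}
    (hζF : ζ ∉ Set.range (algebraMap F L)) (hq : Nat.card F < (minpoly F ζ).natDegree) {a w : V}
    (haw : ∀ x y : L, x • a + y • w = 0 → x = 0 ∧ y = 0) {y : (Fin 2 → F) → V}
    (hy : ∀ v, v ≠ 0 → y v = a + (algebraMap F L (v 0) / poleForm F ζ v) • w)
    (h0 : ∀ v, v ≠ 0 → y v ≠ 0) :
    IsNRCParametrization (Nat.card F) (curve y h0) := by
  apply isNRCParametrization_of_linearIndependent h0
  have : Fintype (ℙ F (Fin 2 → F)) := Fintype.ofFinite _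
  have hli := linearIndependent_inv_poleForm hq hζF
  rw [Fintype.linearIndependent_iff] at hli ⊢
  intro g hg
  have hg' : algebraMap F L (∑ p, g p) • a + (∑ p : ℙ F (Fin 2 → F),
      (g p * p.rep 0) • (poleForm F ζ p.rep)⁻¹) • w = 0 := by
    rw [← hg, Finset.sum_smul, map_sum, Finset.sum_smul, ← Finset.sum_add_distrib]
    refine Finset.sum_congr rfl fun p _ => ?_
    rw [hy _ p.rep_nonzero, ← algebraMap_smul L (g p), smul_add, smul_smul, Algebra.smul_def,
      map_mul, div_eq_mul_inv, mul_assoc]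
  obtain ⟨h1, h2⟩ := haw _ _ hg'
  have h3 := hli _ h2
  intro p
  -- The `w`-component gives no information at the point with `s = 0`; there the `a`-component,
  -- which says that the coefficients sum to zero, decides.
  by_cases hp : p.rep 0 = 0
  · rw [map_eq_zero, Finset.sum_eq_single p] at h1
    · exact h1
    · intro p' _ hp'
      refine (mul_eq_zero.1 (h3 p')).resolve_right fun h0' => ?_
      exact rep_cross_ne_zero hp' (by simp [hp, h0'])
    · simp
  · exact (mul_eq_zero.1 (h3 p)).resolve_right hp

end curves

/-! ### Points and joins in terms of spanning vectors. -/

section points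

variable {k V : Type*} [Field k] [AddCommGroup V] [Module k V]

theorem Projectivization.exists_submodule_eq (X : ℙ k V) :
    ∃ x : V, x ≠ 0 ∧ X.submodule = Submodule.span k {x} :=
  ⟨X.rep, X.rep_nonzero, X.submodule_eq⟩

theorem Projectivization.ne_zero_of_submodule_eq {X : ℙ k V} {x : V}
    (h : X.submodule = Submodule.span k {x}) : x ≠ 0 := by
  rintro rfl
  have := X.finrank_submodule
  rw [h, Submodule.span_zero_singleton, finrank_bot] at this
  omega

theorem Projectivization.Subspace.mem_iff_of_submodule_eq {X : ℙ k V} {x : V}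
    (h : X.submodule = Submodule.span k {x}) (S : Projectivization.Subspace k V) :
    X ∈ S ↔ x ∈ S.submodule := by
  have hx := Projectivization.ne_zero_of_submodule_eq h
  have : X = Projectivization.mk k x hx := Projectivization.submodule_injective h
  rw [this, Projectivization.Subspace.mem_submodule_iff S hx]

theorem Projectivization.Subspace.submodule_span_pair {A B : ℙ k V} {a b : V}
    (ha : A.submodule = Submodule.span k {a}) (hb : B.submodule = Submodule.span k {b}) :
    (Projectivization.Subspace.span {A, B}).submodule = Submodule.span k {a, b} := by
  apply le_antisymm
  · intro v hv
    by_cases hv0 : v = 0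
    · rw [hv0]; exact zero_mem _
    have h := (Projectivization.Subspace.mem_submodule_iff _ hv0).1 hv
    rw [Projectivization.Subspace.mem_span] at h
    refine (Submodule.mk_mem_projectivization_iff _ hv0).1
      (h (Submodule.span k {a, b}).projectivization ?_)
    rintro _ (rfl | rfl)
    · rw [SetLike.mem_coe, Submodule.mem_projectivization_iff_submodule_le, ha]
      exact Submodule.span_mono (by simp)
    · rw [SetLike.mem_coe, Submodule.mem_projectivization_iff_submodule_le, hb]
      exact Submodule.span_mono (by simp)
  · rw [Submodule.span_le]
    rintro _ (rfl | rfl)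
    · exact (mem_iff_of_submodule_eq ha _).1 (subset_span _ (by simp))
    · exact (mem_iff_of_submodule_eq hb _).1 (subset_span _ (by simp))

end points

/-! ### Field reduction, frames of a subplane, and the functional describing `K`. -/

section reduction

variable {F L V : Type*} [Field F] [Field L] [Algebra F L] [AddCommGroup V]
    [Module F V] [Module L V] [IsScalarTower F L V]

theorem mem_fieldReduction_iff {P : ℙ F V} {p : V} (h : P.submodule = Submodule.span F {p})
    (X : ℙ L V) : P ∈ fieldReduction F X ↔ p ∈ X.submodule := by
  rw [fieldReduction, Submodule.mem_projectivization_iff_submodule_le, h,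
    Submodule.span_singleton_le_iff_mem, Submodule.restrictScalars_mem]

theorem mem_reducedSpan_iff {P : ℙ F V} {p : V} (h : P.submodule = Submodule.span F {p})
    (S : Projectivization.Subspace L V) : P ∈ reducedSpan F S ↔ p ∈ S.submodule := by
  have hp := Projectivization.ne_zero_of_submodule_eq h
  constructor
  · intro hP
    have hle : reducedSpan F S ≤ (S.submodule.restrictScalars F).projectivization := by
      refine iSup₂_le fun X hX Q hQ => ?_
      obtain ⟨x, -, hx⟩ := X.exists_submodule_eq
      rw [fieldReduction, Submodule.mem_projectivization_iff_submodule_le] at hQ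
      rw [Submodule.mem_projectivization_iff_submodule_le]
      refine hQ.trans fun v hv => ?_
      rw [Submodule.restrictScalars_mem, hx] at hv
      rw [Submodule.restrictScalars_mem]
      exact (Submodule.span_singleton_le_iff_mem _ _).2
        ((Projectivization.Subspace.mem_iff_of_submodule_eq hx S).1 hX) hv
    have := hle hP
    rwa [Submodule.mem_projectivization_iff_submodule_le, h,
      Submodule.span_singleton_le_iff_mem] at this
  · intro hpS
    have hle : fieldReduction F (Projectivization.mk L p hp) ≤ reducedSpan F S :=
      le_iSup₂_of_le _ ((Projectivization.Subspace.mem_submodule_iff S hp).1 hpS) le_rfl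
    exact hle ((mem_fieldReduction_iff h _).2 (Submodule.mem_span_singleton_self p))

theorem mem_rationalPoints_two {e : Fin 2 → V} {X : ℙ L V} :
    X ∈ rationalPoints F e ↔ ∃ x y : F, X.submodule = Submodule.span L {x • e 0 + y • e 1} := by
  constructor
  · rintro ⟨a, ha⟩
    exact ⟨a 0, a 1, by simpa [Fin.sum_univ_two] using ha⟩
  · rintro ⟨x, y, h⟩
    exact ⟨![x, y], by simpa [Fin.sum_univ_two] using h⟩

theorem submodule_span_rationalPoints {e : Fin 2 → V} (he : LinearIndependent L e) :
    (Projectivization.Subspace.span (rationalPoints F e : Set (ℙ L V))).submodule =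
      Submodule.span L {e 0, e 1} := by
  apply le_antisymm
  · intro v hv
    by_cases hv0 : v = 0
    · rw [hv0]; exact zero_mem _
    have h := (Projectivization.Subspace.mem_submodule_iff _ hv0).1 hv
    rw [Projectivization.Subspace.mem_span] at h
    refine (Submodule.mk_mem_projectivization_iff _ hv0).1
      (h (Submodule.span L {e 0, e 1}).projectivization fun X hX => ?_)
    obtain ⟨x, y, hX⟩ := mem_rationalPoints_two.1 hX
    rw [SetLike.mem_coe, Submodule.mem_projectivization_iff_submodule_le, hX,
      Submodule.span_singleton_le_iff_mem, Submodule.mem_span_pair]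
    exact ⟨algebraMap F L x, algebraMap F L y, by simp⟩
  · rw [Submodule.span_le]
    rintro _ (rfl | rfl)
    · refine (Projectivization.Subspace.mem_submodule_iff _ (he.ne_zero 0)).2
        (Projectivization.Subspace.subset_span _ (mem_rationalPoints_two.2 ⟨1, 0, ?_⟩))
      simp
    · refine (Projectivization.Subspace.mem_submodule_iff _ (he.ne_zero 1)).2
        (Projectivization.Subspace.subset_span _ (mem_rationalPoints_two.2 ⟨0, 1, ?_⟩))
      simp

/-- A subplane has a frame consisting of two points of a given line and a given point off it. -/
theorem IsSubplane.exists_frame {B b : Set (ℙ L V)} (hB : IsSubplane F B) (hb : IsLineOf b B)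
    {T : ℙ L V} (hTB : T ∈ B) (hTb : T ∉ b) :
    ∃ (e : Fin 2 → V) (t : V),
      (∀ x y z : L, x • e 0 + y • e 1 + z • t = 0 → x = 0 ∧ y = 0 ∧ z = 0) ∧
      (∀ X, X ∈ B ↔ ∃ x y z : F,
        X.submodule = Submodule.span L {x • e 0 + y • e 1 + z • t}) ∧
      b = rationalPoints F e ∧ T.submodule = Submodule.span L {t} := by
  obtain ⟨f, hf, rfl⟩ := hB
  obtain ⟨l, -, rfl, X, hX, Y, hY, hXY⟩ := hb
  set W := Submodule.span F (Set.range f) with hW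
  have hmem : ∀ Z, Z ∈ rationalPoints F f ↔ ∃ w ∈ W, Z.submodule = Submodule.span L {w} := by
    intro Z
    constructor
    · rintro ⟨a, ha⟩
      exact ⟨_, Submodule.mem_span_range_iff_exists_fun F |>.2 ⟨a, rfl⟩, by simpa using ha⟩
    · rintro ⟨w, hw, h⟩
      obtain ⟨a, rfl⟩ := (Submodule.mem_span_range_iff_exists_fun F).1 hw
      exact ⟨a, by simpa using h⟩
  have hlt : ∀ {Z : ℙ L V} {z : V}, Z.submodule = Submodule.span L {z} →
      (Z ∈ l ↔ z ∈ l.submodule) := fun h =>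
    Projectivization.Subspace.mem_iff_of_submodule_eq h l
  obtain ⟨x, hxW, hx⟩ := (hmem X).1 hX.1
  obtain ⟨y, hyW, hy⟩ := (hmem Y).1 hY.1
  obtain ⟨t, htW, ht⟩ := (hmem T).1 hTB
  have hxl := (hlt hx).1 hX.2
  have hyl := (hlt hy).1 hY.2
  have htl : t ∉ l.submodule := fun h => hTb ⟨hTB, (hlt ht).2 h⟩
  have hx0 := Projectivization.ne_zero_of_submodule_eq hx
  have hy0 := Projectivization.ne_zero_of_submodule_eq hy
  have hcoef : ∀ a c d : L, a • x + c • y + d • t ∈ l.submodule → d = 0 := by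
    intro a c d h
    by_contra hd
    apply htl
    have h1 : d • t ∈ l.submodule := by
      have := l.submodule.sub_mem h
        (l.submodule.add_mem (l.submodule.smul_mem a hxl) (l.submodule.smul_mem c hyl))
      simpa using this
    exact (l.submodule.smul_mem_iff hd).1 h1
  have hli : ∀ a c d : L, a • x + c • y + d • t = 0 → a = 0 ∧ c = 0 ∧ d = 0 := by
    intro a c d h
    have hd : d = 0 := hcoef a c d (by rw [h]; exact zero_mem _)
    have ha : a = 0 := by
      by_contra ha
      apply hXY
      apply Projectivization.submodule_injective
      have hxy : x = (-(a⁻¹ * c)) • y := by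
        rw [hd, zero_smul, add_zero] at h
        rw [neg_smul, mul_smul, ← smul_neg, ← eq_neg_of_add_eq_zero_left h, smul_smul,
          inv_mul_cancel₀ ha, one_smul]
      have hc : -(a⁻¹ * c) ≠ 0 := by
        intro hc
        rw [hc, zero_smul] at hxy
        exact hx0 hxy
      rw [hx, hy, hxy]
      exact Submodule.span_singleton_smul_eq (IsUnit.mk0 _ hc) _
    refine ⟨ha, ?_, hd⟩
    simpa [ha, hd, hy0] using h
  have hliF : LinearIndependent F ![x, y, t] := by
    rw [Fintype.linearIndependent_iff]
    intro g hg
    rw [Fin.sum_univ_three] at hg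
    have := hli (algebraMap F L (g 0)) (algebraMap F L (g 1)) (algebraMap F L (g 2))
      (by simpa using hg)
    simp only [map_eq_zero] at this
    intro i
    fin_cases i
    exacts [this.1, this.2.1, this.2.2]
  have hfF : LinearIndependent F f := hf.restrict_scalars (by
    intro a c h
    simpa [Algebra.smul_def] using h)
  -- Independence over `L` gives independence over `F`, and `W` has dimension three, so `x, y, t` is
  -- an `F`-basis of `W`.
  have hspan : Submodule.span F (Set.range ![x, y, t]) = W := by
    have : FiniteDimensional F W := FiniteDimensional.span_of_finite F (Set.finite_range f)
    apply Submodule.eq_of_le_of_finrank_eq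
    · rw [Submodule.span_le]
      rintro _ ⟨i, rfl⟩
      fin_cases i
      exacts [hxW, hyW, htW]
    · rw [finrank_span_eq_card hliF, hW, finrank_span_eq_card hfF]
  have hW' : ∀ w, w ∈ W ↔ ∃ a c d : F, w = a • x + c • y + d • t := by
    intro w
    rw [← hspan, Submodule.mem_span_range_iff_exists_fun]
    constructor
    · rintro ⟨g, rfl⟩
      exact ⟨g 0, g 1, g 2, by simp [Fin.sum_univ_three]⟩
    · rintro ⟨a, c, d, rfl⟩
      exact ⟨![a, c, d], by simp [Fin.sum_univ_three]⟩
  refine ⟨![x, y], t, by simpa using hli, fun Z => ?_, ?_, ht⟩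
  · rw [hmem]
    constructor
    · rintro ⟨w, hw, h⟩
      obtain ⟨a, c, d, rfl⟩ := (hW' w).1 hw
      exact ⟨a, c, d, by simpa using h⟩
    · rintro ⟨a, c, d, h⟩
      exact ⟨_, (hW' _).2 ⟨a, c, d, rfl⟩, by simpa using h⟩
  · ext Z
    rw [mem_rationalPoints_two]
    constructor
    · rintro ⟨h1, h2⟩
      obtain ⟨w, hw, h⟩ := (hmem Z).1 h1
      obtain ⟨a, c, d, rfl⟩ := (hW' w).1 hw
      have hd := hcoef (algebraMap F L a) (algebraMap F L c) (algebraMap F L d)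
        (by simpa using (hlt h).1 h2)
      rw [map_eq_zero] at hd
      exact ⟨a, c, by simpa [hd] using h⟩
    · rintro ⟨a, c, h⟩
      simp only [Matrix.cons_val_zero, Matrix.cons_val_one] at h
      refine ⟨(hmem Z).2 ⟨_, (hW' _).2 ⟨a, c, 0, by simp⟩, h⟩, (hlt h).2 ?_⟩
      rw [← algebraMap_smul L a, ← algebraMap_smul L c]
      exact add_mem (l.submodule.smul_mem _ hxl) (l.submodule.smul_mem _ hyl)

/-- An `L`-hyperplane `M` and an `F`-subspace `K` in which `M` is an `F`-hyperplane are described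
by a common linear functional. -/
theorem exists_functional_of_hyperplane [FiniteDimensional F L] [FiniteDimensional L V]
    {M : Submodule L V} (hM : Module.finrank L M + 1 = Module.finrank L V) {K : Submodule F V}
    (hK : Module.finrank F K = Module.finrank F (M.restrictScalars F) + 1)
    (hMK : M.restrictScalars F ≤ K) :
    ∃ f : V →ₗ[L] L, (∀ x, x ∈ M ↔ f x = 0) ∧ ∀ x, x ∈ K ↔ ∃ c : F, f x = algebraMap F L c := by
  have : FiniteDimensional F V := FiniteDimensional.trans F L V
  obtain ⟨k, hkK, hkM⟩ : ∃ k ∈ K, k ∉ M := by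
    by_contra! h
    have : K ≤ M.restrictScalars F := fun x hx => h x hx
    have := Submodule.finrank_mono this
    omega
  obtain ⟨g, hgk, hg⟩ := Submodule.exists_dual_map_eq_bot_of_notMem hkM inferInstance
  have hMg : M ≤ LinearMap.ker g := by
    intro x hx
    have : g x ∈ M.map g := Submodule.mem_map_of_mem hx
    rw [hg] at this
    simpa using this
  have hker : M = LinearMap.ker g := by
    apply Submodule.eq_of_le_of_finrank_le hMg
    have h1 := LinearMap.finrank_range_add_finrank_ker g
    have h2 : 0 < Module.finrank L (LinearMap.range g) := by
      rw [Module.finrank_pos_iff_exists_ne_zero]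
      exact ⟨⟨g k, k, rfl⟩, fun h => hgk (congrArg Subtype.val h)⟩
    omega
  -- The scaling gives `k` the value `1`; as `K = M + F k`, the values on `K` are then exactly those
  -- in `F`.
  refine ⟨(g k)⁻¹ • g, fun x => ?_, fun x => ?_⟩
  · rw [hker]; simp [hgk]
  have hKeq : M.restrictScalars F ⊔ Submodule.span F {k} = K := by
    apply Submodule.eq_of_le_of_finrank_le
    · exact sup_le hMK ((Submodule.span_singleton_le_iff_mem _ _).2 hkK)
    · rw [hK]
      have hlt : M.restrictScalars F < M.restrictScalars F ⊔ Submodule.span F {k} := by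
        refine lt_of_le_of_ne le_sup_left fun h => hkM ?_
        have : k ∈ M.restrictScalars F ⊔ Submodule.span F {k} :=
          Submodule.mem_sup_right (Submodule.mem_span_singleton_self k)
        rwa [← h] at this
      exact Submodule.finrank_lt_finrank_of_lt hlt
  constructor
  · intro hx
    rw [← hKeq, Submodule.mem_sup] at hx
    obtain ⟨m, hm, z, hz, rfl⟩ := hx
    obtain ⟨c, rfl⟩ := Submodule.mem_span_singleton.1 hz
    have hm0 : g m = 0 := hMg hm
    refine ⟨c, ?_⟩
    rw [← algebraMap_smul L c k]
    simp only [LinearMap.smul_apply, map_add, hm0, map_smul, smul_eq_mul]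
    field_simp
    rw [zero_add]
  · rintro ⟨c, hc⟩
    have hm : x - c • k ∈ M := by
      rw [hker, LinearMap.mem_ker, map_sub, ← algebraMap_smul L c k, map_smul, ← hc]
      simp only [LinearMap.smul_apply, smul_eq_mul]
      field_simp
      simp
    have := K.add_mem (hMK hm) (K.smul_mem c hkK)
    simpa using this

end reduction

/-! ### The representation of a whole subspace. -/

section representation

variable {F L V : Type*} [Field F] [Field L] [Algebra F L] [AddCommGroup V]
    [Module F V] [Module L V] [IsScalarTower F L V]

theorem restrictScalars_submodule_le {linf : Projectivization.Subspace L V}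
    {K : Projectivization.Subspace F V} (h : ∀ X ∈ linf, fieldReduction F X ≤ K) :
    linf.submodule.restrictScalars F ≤ K.submodule := by
  intro v hv
  by_cases hv0 : v = 0
  · rw [hv0]; exact zero_mem _
  exact (Projectivization.Subspace.mem_submodule_iff K hv0).2
    (h _ ((Projectivization.Subspace.mem_submodule_iff linf hv0).1 hv)
      ((mem_fieldReduction_iff rfl _).2 (Submodule.mem_span_singleton_self v)))

/-- A vector `x` lies on only one `L`-point, namely `L x`, so the union over points of `E` is just
`E ∩ K` off infinity. -/
theorem abbImage_diff_eq (K : Projectivization.Subspace F V)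
    (E linf : Projectivization.Subspace L V) :
    abbImage K ((E : Set (ℙ L V)) \ linf) =
      ((E.submodule.restrictScalars F ⊓ K.submodule).projectivization : Set (ℙ F V)) \
        reducedSpan F linf := by
  ext P
  obtain ⟨x, hx0, hx⟩ := P.exists_submodule_eq
  rw [abbImage, Set.mem_iUnion₂, Set.mem_sdiff, SetLike.mem_coe, SetLike.mem_coe,
    mem_reducedSpan_iff hx, Submodule.mem_projectivization_iff_submodule_le, hx,
    Submodule.span_singleton_le_iff_mem]
  constructor
  · rintro ⟨X, ⟨hXE, hXl⟩, hPX, hPK⟩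
    rw [SetLike.mem_coe, mem_fieldReduction_iff hx] at hPX
    have hX : X = Projectivization.mk L x hx0 := by
      obtain ⟨z, -, hz⟩ := X.exists_submodule_eq
      rw [hz] at hPX
      obtain ⟨c, hc⟩ := Submodule.mem_span_singleton.1 hPX
      have hc0 : c ≠ 0 := fun h => hx0 (by rw [← hc, h, zero_smul])
      apply Projectivization.submodule_injective
      rw [hz, Projectivization.submodule_mk, ← hc]
      exact (Submodule.span_singleton_smul_eq (IsUnit.mk0 c hc0) z).symm
    rw [hX, SetLike.mem_coe, ← Projectivization.Subspace.mem_submodule_iff] at hXE hXl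
    exact ⟨⟨hXE, (Projectivization.Subspace.mem_iff_of_submodule_eq hx K).1 hPK⟩, hXl⟩
  · rintro ⟨⟨h1, h2⟩, h3⟩
    refine ⟨Projectivization.mk L x hx0, ⟨?_, ?_⟩, ?_, ?_⟩
    · exact (Projectivization.Subspace.mem_submodule_iff E hx0).1 h1
    · exact fun h => h3 ((Projectivization.Subspace.mem_submodule_iff linf hx0).2 h)
    · exact (mem_fieldReduction_iff hx _).2 (Submodule.mem_span_singleton_self x)
    · exact (Projectivization.Subspace.mem_iff_of_submodule_eq hx K).2 h2

end representation

/-! ### The ruled surface. -/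

theorem theorem4p3 {F L : Type*} [Field F] [Finite F] [Field L] [Finite L] [Algebra F L]
    (q n : ℕ) (hq : Nat.card F = q) (hn : Module.finrank F L = n)
    -- the line at infinity, and the `2n`-subspace `K` containing its field reduction
    (linf : Projectivization.Subspace L (Fin 3 → L))
    (hlinf : Module.finrank L linf.submodule = 2)
    (K : Projectivization.Subspace F (Fin 3 → L))
    (hK : Module.finrank F K.submodule = 2 * n + 1)
    (hlK : ∀ X ∈ linf, fieldReduction F X ≤ K)
    -- the subplane `B`, tangent to the line at infinity at `T`
    (B : Set (ℙ L (Fin 3 → L))) (hB : IsSubplane F B)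
    (T : ℙ L (Fin 3 → L)) (hT : B ∩ (linf : Set (ℙ L (Fin 3 → L))) = {T})
    (b : Set (ℙ L (Fin 3 → L))) (hb : IsLineOf b B) (hTb : T ∉ b)
    (Θ : ℙ L (Fin 3 → L))
    (hΘ : (Projectivization.Subspace.span b : Set (ℙ L (Fin 3 → L))) ∩ linf = {Θ}) :
    -- `φ(⟨b⟩)` is an `n`-subspace of the affine space
    (∃ N : Projectivization.Subspace F (Fin 3 → L), Module.finrank F N.submodule = n + 1 ∧
      abbImage K ((Projectivization.Subspace.span b : Set (ℙ L (Fin 3 → L))) \ linf) =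
        (N : Set (ℙ F (Fin 3 → L))) \ reducedSpan F linf) ∧
    ∃ (δ' : ℕ) (C₀ C₁ : Set (ℙ F (Fin 3 → L))) (κ : C₀ → C₁),
      IsNormalRationalCurve (min q (pointDegree F Θ b)) C₀ ∧
      C₀ ⊆ abbImage K ((Projectivization.Subspace.span b : Set (ℙ L (Fin 3 → L))) \ linf) ∧
      IsNormalRationalCurve δ' C₁ ∧
      C₁ ⊆ fieldReduction F T ∧
      (pointDegree F Θ b < q → δ' + 1 = pointDegree F Θ b) ∧
      (q ≤ pointDegree F Θ b → δ' = q - 1 ∨ δ' = q) ∧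
      IsCurveProjectivity (min q (pointDegree F Θ b)) δ' κ ∧
      abbImage K (B \ linf) =
        (⋃ X : C₀, (Projectivization.Subspace.span {(X : ℙ F (Fin 3 → L)), (κ X : ℙ F (Fin 3 → L))} :
          Set (ℙ F (Fin 3 → L)))) \ reducedSpan F linf := by
  have : FiniteDimensional F L := Module.Finite.of_finite
  have hTm : T ∈ B ∩ (linf : Set (ℙ L (Fin 3 → L))) := hT ▸ rfl
  obtain ⟨e, t, hli, hBmem, rfl, ht⟩ := hB.exists_frame hb hTm.1 hTb
  have hbB : ∀ X ∈ rationalPoints F e, X ∈ B := fun X hX => by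
    obtain ⟨l, -, h, -⟩ := hb
    rw [h] at hX
    exact hX.1
  have hbl : ∀ X ∈ rationalPoints F e, X ∉ linf := fun X hX hXl => by
    have : X ∈ B ∩ (linf : Set (ℙ L (Fin 3 → L))) := ⟨hbB X hX, hXl⟩
    rw [hT] at this
    exact hTb (this ▸ hX)
  have he2 : ∀ x y : L, x • e 0 + y • e 1 = 0 → x = 0 ∧ y = 0 := fun x y h => by
    have := hli x y 0 (by rw [h, zero_smul, add_zero])
    exact ⟨this.1, this.2.1⟩
  have he : LinearIndependent L e := by
    rw [Fintype.linearIndependent_iff]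
    intro g hg
    rw [Fin.sum_univ_two] at hg
    have := he2 _ _ hg
    intro i
    fin_cases i
    exacts [this.1, this.2]
  have hfl : Module.finrank F (linf.submodule.restrictScalars F) = n * 2 := by
    rw [← hn, ← hlinf]
    exact (Module.finrank_mul_finrank F L linf.submodule).symm
  obtain ⟨f, hfl0, hfK⟩ := exists_functional_of_hyperplane (F := F) (M := linf.submodule)
    (K := K.submodule) (by simp [hlinf]) (by rw [hfl, hK, mul_comm])
    (restrictScalars_submodule_le hlK)
  have hpt : ∀ x y : F, x • e 0 + y • e 1 ≠ 0 → f (x • e 0 + y • e 1) ≠ 0 := by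
    intro x y h hf
    refine hbl (Projectivization.mk L _ h) (mem_rationalPoints_two.2 ⟨x, y, rfl⟩) ?_
    rwa [← Projectivization.Subspace.mem_submodule_iff, hfl0]
  have hf1 : f (e 1) ≠ 0 := by
    have := hpt 0 1
    simp only [zero_smul, one_smul, zero_add] at this
    exact this (he.ne_zero 1)
  have hft : f t = 0 := by
    rw [← hfl0]
    exact (Projectivization.Subspace.mem_iff_of_submodule_eq ht linf).1 hTm.2
  -- Chosen so that `f` vanishes on `e 0 + ζ e 1`, which thus spans `Θ`. If `ζ` were in `F`, this
  -- would be a point of `b` at infinity.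
  obtain ⟨ζ, hζ⟩ : ∃ ζ, f (e 0) = -ζ * f (e 1) := ⟨-(f (e 0) / f (e 1)), by field_simp⟩
  have hζF : ζ ∉ Set.range (algebraMap F L) := by
    rintro ⟨c, rfl⟩
    refine hpt 1 c (fun h => ?_) ?_
    · have := he2 1 (algebraMap F L c) (by simpa using h)
      exact one_ne_zero this.1
    · rw [← algebraMap_smul L c, one_smul, map_add, map_smul, hζ, smul_eq_mul]; ring
  have hw0 : e 0 + ζ • e 1 ≠ 0 := fun h => one_ne_zero (he2 1 ζ (by simpa using h)).1
  have hΘw : Θ.submodule = Submodule.span L {e 0 + ζ • e 1} := by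
    have h : Projectivization.mk L _ hw0 ∈ ({Θ} : Set (ℙ L (Fin 3 → L))) := by
      rw [← hΘ]
      constructor
      · rw [SetLike.mem_coe, ← Projectivization.Subspace.mem_submodule_iff,
          submodule_span_rationalPoints he, Submodule.mem_span_pair]
        exact ⟨1, ζ, by simp⟩
      · rw [SetLike.mem_coe, ← Projectivization.Subspace.mem_submodule_iff, hfl0, map_add,
          map_smul, hζ, smul_eq_mul]; ring
    rw [← (show _ = Θ from h), Projectivization.submodule_mk]
  have hint : IsIntegral F ζ := Algebra.IsIntegral.isIntegral ζ
  have hdeg : pointDegree F Θ (rationalPoints F e) = (minpoly F ζ).natDegree := by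
    rw [pointDegree_eq he rfl hΘw, IntermediateField.adjoin.finrank hint]
  have ha0 : f ((f (e 1))⁻¹ • e 1) = 1 := by simp [hf1]
  refine ⟨⟨_, ?_, abbImage_diff_eq K _ linf⟩, ?_⟩
  · rw [OrderIso.apply_symm_apply]
    have hE : Module.finrank F ((Projectivization.Subspace.span
        (rationalPoints F e : Set (ℙ L (Fin 3 → L)))).submodule.restrictScalars F) = n * 2 := by
      rw [submodule_span_rationalPoints he, ← hn]
      have h2 : Module.finrank L (Submodule.span L {e 0, e 1}) = 2 := by
        have := finrank_span_eq_card he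
        rwa [Fintype.card_fin, show Set.range e = {e 0, e 1} by
          ext; simp [Fin.exists_fin_two, eq_comm]] at this
      conv_rhs => rw [← h2]
      exact (Module.finrank_mul_finrank F L (Submodule.span L {e 0, e 1})).symm
    have hV : Module.finrank F (Fin 3 → L) = n * 3 := by
      rw [← hn, ← Module.finrank_mul_finrank F L (Fin 3 → L)]; simp
    -- Since `e 1` is off infinity, `⟨b⟩` and `K` together span everything, and the intersection has
    -- dimension `2n + (2n + 1) - 3n = n + 1`.
    have hsup : (Projectivization.Subspace.span
        (rationalPoints F e : Set (ℙ L (Fin 3 → L)))).submodule.restrictScalars F ⊔ K.submodule =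
          ⊤ := by
      rw [eq_top_iff]
      intro v _
      have h1 : f v • (f (e 1))⁻¹ • e 1 ∈ (Projectivization.Subspace.span
          (rationalPoints F e : Set (ℙ L (Fin 3 → L)))).submodule.restrictScalars F := by
        rw [Submodule.restrictScalars_mem, submodule_span_rationalPoints he]
        exact Submodule.smul_mem _ _ (Submodule.smul_mem _ _ (Submodule.subset_span (by simp)))
      have h2 : v - f v • (f (e 1))⁻¹ • e 1 ∈ K.submodule :=
        (hfK _).2 ⟨0, by rw [map_sub, map_smul, ha0]; simp⟩
      have := Submodule.add_mem_sup h1 h2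
      simpa using this
    have := Submodule.finrank_sup_add_finrank_inf_eq ((Projectivization.Subspace.span
        (rationalPoints F e : Set (ℙ L (Fin 3 → L)))).submodule.restrictScalars F) K.submodule
    rw [hsup, finrank_top, hE, hV, hK] at this
    omega
  have hfU : ∀ v : Fin 2 → F, f (v 0 • e 0 + v 1 • e 1) = f (e 1) * poleForm F ζ v := by
    intro v
    rw [← algebraMap_smul L (v 0), ← algebraMap_smul L (v 1), map_add, map_smul, map_smul, hζ,
      poleForm, smul_eq_mul, smul_eq_mul]
    ring
  have hpole : ∀ v : Fin 2 → F, v ≠ 0 → poleForm F ζ v ≠ 0 := fun v hv =>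
    sub_mul_ne_zero_of_notMem_range hζF hv
  obtain ⟨y₀, hy₀⟩ : ∃ y : (Fin 2 → F) → Fin 3 → L, ∀ v,
      y v = (f (e 1) * poleForm F ζ v)⁻¹ • (v 0 • e 0 + v 1 • e 1) := ⟨_, fun _ => rfl⟩
  obtain ⟨y₁, hy₁⟩ : ∃ y : (Fin 2 → F) → Fin 3 → L, ∀ v,
      y v = (f (e 1) * poleForm F ζ v)⁻¹ • t := ⟨_, fun _ => rfl⟩
  have ht0 : t ≠ 0 := Projectivization.ne_zero_of_submodule_eq ht
  have hfy₀ : ∀ v, v ≠ 0 → f (y₀ v) = 1 := fun v hv => by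
    rw [hy₀, map_smul, hfU, smul_eq_mul, inv_mul_cancel₀ (mul_ne_zero hf1 (hpole v hv))]
  have hfy₁ : ∀ v, f (y₁ v) = 0 := fun v => by rw [hy₁, map_smul, hft, smul_zero]
  have h₀ : ∀ v, v ≠ 0 → y₀ v ≠ 0 := fun v hv h => by
    have := hfy₀ v hv
    rw [h, map_zero] at this
    exact zero_ne_one this
  have h₁ : ∀ v, v ≠ 0 → y₁ v ≠ 0 := fun v hv => by
    rw [hy₁]
    exact smul_ne_zero (inv_ne_zero (mul_ne_zero hf1 (hpole v hv))) ht0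
  have hs₀ : ∀ c : F, c ≠ 0 → ∀ v, ∃ c' : F, y₀ (c • v) = c' • y₀ v := fun c hc v => by
    refine ⟨1, ?_⟩
    have hc' : algebraMap F L c ≠ 0 := by simpa using hc
    rw [one_smul, hy₀, hy₀, poleForm_smul, Pi.smul_apply, Pi.smul_apply, smul_assoc, smul_assoc,
      ← smul_add, ← algebraMap_smul L c, smul_smul]
    congr 1
    rw [mul_left_comm, mul_inv, mul_right_comm, inv_mul_cancel₀ hc', one_mul]
  have hs₁ : ∀ c : F, c ≠ 0 → ∀ v, ∃ c' : F, y₁ (c • v) = c' • y₁ v := fun c hc v => by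
    refine ⟨c⁻¹, ?_⟩
    rw [hy₁, hy₁, poleForm_smul, ← algebraMap_smul L c⁻¹, smul_smul, map_inv₀, mul_left_comm,
      mul_inv]
  -- Substituting `v 1 = (v 1 - v 0 ζ) + v 0 ζ` separates a constant term from a multiple of the
  -- vector of `Θ`.
  have hform₀ : ∀ v, v ≠ 0 → y₀ v = (f (e 1))⁻¹ • e 1 +
      (algebraMap F L (v 0) / poleForm F ζ v) • (f (e 1))⁻¹ • (e 0 + ζ • e 1) := fun v hv => by
    have hp := hpole v hv
    have h1 : algebraMap F L (v 1) = poleForm F ζ v + algebraMap F L (v 0) * ζ := by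
      rw [poleForm]; ring
    rw [hy₀, ← algebraMap_smul L (v 0), ← algebraMap_smul L (v 1), h1]
    match_scalars <;> field_simp
  have hform₁ : ∀ v, v ≠ 0 → y₁ v = (poleForm F ζ v)⁻¹ • (f (e 1))⁻¹ • t := fun v _ => by
    rw [hy₁, mul_inv, smul_smul, mul_comm]
  have haw : ∀ x y : L, x • (f (e 1))⁻¹ • e 1 + y • (f (e 1))⁻¹ • (e 0 + ζ • e 1) = 0 →
      x = 0 ∧ y = 0 := fun x y h => by
    have h' := he2 (y * (f (e 1))⁻¹) (x * (f (e 1))⁻¹ + y * (f (e 1))⁻¹ * ζ) (by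
      rw [← h]; module)
    have hy : y = 0 := (mul_eq_zero.1 h'.1).resolve_right (inv_ne_zero hf1)
    have h2 := h'.2
    rw [hy, zero_mul, zero_mul, add_zero] at h2
    exact ⟨(mul_eq_zero.1 h2).resolve_right (inv_ne_zero hf1), hy⟩
  have hτ : (f (e 1))⁻¹ • t ≠ 0 := smul_ne_zero (inv_ne_zero hf1) ht0
  -- Needed for `κ` to be well defined as the map matching equal parameters.
  have hinj : Function.Injective (curve y₀ h₀) := by
    intro p p' h
    rw [curve, curve, Projectivization.mk_eq_mk_iff'] at h
    obtain ⟨c, hc⟩ := h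
    by_contra hpp
    apply rep_cross_ne_zero hpp
    obtain ⟨r, hr, r', hr', hrr⟩ : ∃ r : L, r ≠ 0 ∧ ∃ r' : L, r' ≠ 0 ∧
        r • (p.rep 0 • e 0 + p.rep 1 • e 1) = r' • (p'.rep 0 • e 0 + p'.rep 1 • e 1) := by
      have hc0 : c ≠ 0 := by
        rintro rfl
        rw [zero_smul] at hc
        exact h₀ _ p.rep_nonzero hc.symm
      refine ⟨_, inv_ne_zero (mul_ne_zero hf1 (hpole _ p.rep_nonzero)),
        algebraMap F L c * (f (e 1) * poleForm F ζ p'.rep)⁻¹, mul_ne_zero (by simpa using hc0)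
        (inv_ne_zero (mul_ne_zero hf1 (hpole _ p'.rep_nonzero))), ?_⟩
      rw [← hy₀, ← hc, hy₀, ← algebraMap_smul L c, smul_smul]
    simp only [← algebraMap_smul L (p.rep _), ← algebraMap_smul L (p'.rep _)] at hrr
    obtain ⟨z0, z1⟩ := he2 (r * algebraMap F L (p.rep 0) - r' * algebraMap F L (p'.rep 0))
      (r * algebraMap F L (p.rep 1) - r' * algebraMap F L (p'.rep 1)) (by
        rw [← sub_eq_zero] at hrr
        rw [← hrr]; module)
    have : algebraMap F L (p.rep 1 * p'.rep 0 - p'.rep 1 * p.rep 0) = 0 := by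
      apply (mul_eq_zero.1 ?_).resolve_left hr
      rw [map_sub, map_mul, map_mul]
      linear_combination (algebraMap F L (p'.rep 0)) * z1 - (algebraMap F L (p'.rep 1)) * z0
    exact (map_eq_zero _).1 this
  obtain ⟨δ', hN₀, hN₁, hlt, hge⟩ : ∃ δ' : ℕ,
      IsNRCParametrization (min q (pointDegree F Θ (rationalPoints F e))) (curve y₀ h₀) ∧
      IsNRCParametrization δ' (curve y₁ h₁) ∧
      (pointDegree F Θ (rationalPoints F e) < q →
        δ' + 1 = pointDegree F Θ (rationalPoints F e)) ∧
      (q ≤ pointDegree F Θ (rationalPoints F e) → δ' = q - 1 ∨ δ' = q) := by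
    rw [hdeg]
    subst hq
    -- Equality belongs to the first case and yields `δ' = q - 1`; degree above `q` yields `δ' = q`.
    rcases le_or_gt (minpoly F ζ).natDegree (Nat.card F) with h | h
    · refine ⟨(minpoly F ζ).natDegree - 1, ?_,
        isNRCParametrization_inv_poleForm hint hζF hτ hform₁ h₁ hs₁, fun _ => ?_,
        fun h' => Or.inl (by rw [le_antisymm h h'])⟩
      · rw [min_eq_right h]
        exact isNRCParametrization_add_div_poleForm hint hζF haw hform₀ h₀ hs₀
      · have := minpoly.natDegree_pos hint
        omega
    · refine ⟨Nat.card F, ?_, isNRCParametrization_inv_poleForm_of_lt hζF h hτ hform₁ h₁,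
        fun h' => absurd h h'.not_gt, fun _ => Or.inr rfl⟩
      rw [min_eq_left h.le]
      exact isNRCParametrization_add_div_poleForm_of_lt hζF h haw hform₀ h₀
  obtain ⟨κ, hκ⟩ : ∃ κ : Set.range (curve y₀ h₀) → Set.range (curve y₁ h₁),
      ∀ (X : Set.range (curve y₀ h₀)) p,
      (X : ℙ F (Fin 3 → L)) = curve y₀ h₀ p → (κ X : ℙ F (Fin 3 → L)) = curve y₁ h₁ p := by
    choose g hg using fun X : Set.range (curve y₀ h₀) => X.2
    exact ⟨fun X => ⟨curve y₁ h₁ (g X), Set.mem_range_self _⟩, fun X p h =>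
      congrArg (curve y₁ h₁) (hinj ((hg X).trans h))⟩
  refine ⟨δ', Set.range (curve y₀ h₀), Set.range (curve y₁ h₁),
    κ, ⟨_, hN₀, rfl⟩, ?_, ⟨_, hN₁, rfl⟩, ?_,
    hlt, hge, ⟨_, _, hN₀, rfl, hN₁, rfl, LinearEquiv.refl F _, fun p X h => ?_⟩, ?_⟩
  · rintro _ ⟨p, rfl⟩
    rw [abbImage_diff_eq]
    refine ⟨(Submodule.mk_mem_projectivization_iff _ _).2 ⟨?_, ?_⟩, fun h => ?_⟩
    · rw [SetLike.mem_coe, Submodule.restrictScalars_mem, submodule_span_rationalPoints he, hy₀]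
      refine Submodule.smul_mem _ _ (Submodule.mem_span_pair.2
        ⟨algebraMap F L (p.rep 0), algebraMap F L (p.rep 1), by simp⟩)
    · exact (hfK _).2 ⟨1, by rw [hfy₀ _ p.rep_nonzero, map_one]⟩
    · rw [SetLike.mem_coe, mem_reducedSpan_iff (P := curve y₀ h₀ p) (p := y₀ p.rep) rfl, hfl0,
        hfy₀ _ p.rep_nonzero] at h
      exact one_ne_zero h
  · rintro _ ⟨p, rfl⟩
    rw [SetLike.mem_coe, mem_fieldReduction_iff (P := curve y₁ h₁ p) (p := y₁ p.rep) rfl, ht, hy₁]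
    exact Submodule.smul_mem _ _ (Submodule.mem_span_singleton_self t)
  · rw [hκ X p h]
    congr 1
    exact (congrFun Projectivization.map_id p).symm
  · ext P
    obtain ⟨x, hx0, hx⟩ := P.exists_submodule_eq
    rw [abbImage, Set.mem_iUnion₂, Set.mem_sdiff, Set.mem_iUnion, SetLike.mem_coe,
      mem_reducedSpan_iff hx, hfl0]
    constructor
    · rintro ⟨X, ⟨hXB, hXl⟩, hPX, hPK⟩
      obtain ⟨a, c, d, hX⟩ := (hBmem X).1 hXB
      rw [SetLike.mem_coe, mem_fieldReduction_iff hx, hX] at hPX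
      rw [SetLike.mem_coe, Projectivization.Subspace.mem_iff_of_submodule_eq hx, hfK] at hPK
      rw [SetLike.mem_coe, Projectivization.Subspace.mem_iff_of_submodule_eq hX, hfl0] at hXl
      obtain ⟨μ, rfl⟩ := Submodule.mem_span_singleton.1 hPX
      obtain ⟨k, hk⟩ := hPK
      have hfd : f (d • t) = 0 := by rw [← algebraMap_smul L d, map_smul, hft, smul_zero]
      rw [map_smul, map_add, hfd, add_zero] at hk
      rw [map_add, hfd, add_zero] at hXl
      have hv : ![a, c] ≠ 0 := by
        intro h
        have h0 := congrFun h 0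
        have h1 := congrFun h 1
        simp only [Matrix.cons_val_zero, Matrix.cons_val_one, Pi.zero_apply] at h0 h1
        exact hXl (by simp [h0, h1])
      have hμ0 : μ ≠ 0 := fun h => hx0 (by rw [h, zero_smul])
      have hfv := hfU ![a, c]
      simp only [Matrix.cons_val_zero, Matrix.cons_val_one] at hfv
      -- Membership in `K` forces the scalar `μ`: the value of `f` must be some `k` in `F`. The
      -- point is then `k y₀ + (k d) y₁`.
      have hμ : μ = algebraMap F L k * (f (e 1) * poleForm F ζ ![a, c])⁻¹ := by
        rw [← hk, ← hfv, smul_eq_mul, mul_inv_cancel_right₀ hXl]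
      refine ⟨⟨⟨curve y₀ h₀ (Projectivization.mk F _ hv), Set.mem_range_self _⟩, ?_⟩, ?_⟩
      · rw [hκ ⟨_, Set.mem_range_self _⟩ _ rfl, Subtype.coe_mk, curve_mk h₀ hs₀, curve_mk h₁ hs₁, SetLike.mem_coe,
          Projectivization.Subspace.mem_iff_of_submodule_eq hx,
          Projectivization.Subspace.submodule_span_pair (Projectivization.submodule_mk _ _)
            (Projectivization.submodule_mk _ _), Submodule.mem_span_pair]
        refine ⟨k, k * d, ?_⟩
        rw [hy₀, hy₁, hμ, ← algebraMap_smul L k, ← algebraMap_smul L (k * d),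
          ← algebraMap_smul L d, map_mul]
        simp only [Matrix.cons_val_zero, Matrix.cons_val_one, smul_add, smul_smul]
        congr 2
        ring
      · rw [map_smul, map_add, hfd, add_zero]
        exact mul_ne_zero hμ0 hXl
    · rintro ⟨⟨X, hPX⟩, hPl⟩
      obtain ⟨p, hp⟩ := X.2
      rw [hκ X p hp.symm, ← hp, SetLike.mem_coe,
        Projectivization.Subspace.mem_iff_of_submodule_eq hx, curve, curve,
        Projectivization.Subspace.submodule_span_pair (Projectivization.submodule_mk _ _)
            (Projectivization.submodule_mk _ _), Submodule.mem_span_pair] at hPX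
      obtain ⟨k, d, rfl⟩ := hPX
      have hfk : f (k • y₀ p.rep + d • y₁ p.rep) = algebraMap F L k := by
        rw [← algebraMap_smul L k, ← algebraMap_smul L d, map_add, map_smul, map_smul,
          hfy₀ _ p.rep_nonzero, hfy₁]
        simp
      have hk : k ≠ 0 := by
        rintro rfl
        exact hPl (by rw [hfk, map_zero])
      -- Off infinity `k ≠ 0`, so dividing by it recovers a point of `B` with third coordinate `d /
      -- k`.
      have hX : (Projectivization.mk L _ hx0).submodule = Submodule.span L
          {p.rep 0 • e 0 + p.rep 1 • e 1 + (d / k) • t} := by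
        rw [Projectivization.submodule_mk]
        have hk' : algebraMap F L k ≠ 0 := by simpa using hk
        have : k • y₀ p.rep + d • y₁ p.rep =
            (algebraMap F L k * (f (e 1) * poleForm F ζ p.rep)⁻¹) •
              (p.rep 0 • e 0 + p.rep 1 • e 1 + (d / k) • t) := by
          rw [hy₀, hy₁, ← algebraMap_smul L k, ← algebraMap_smul L d,
            ← algebraMap_smul L (d / k), smul_add _ _ ((algebraMap F L (d / k)) • t), smul_smul,
            smul_smul, smul_smul, map_div₀]
          congr 2
          field_simp
        rw [this]
        exact Submodule.span_singleton_smul_eq (IsUnit.mk0 _ (mul_ne_zero hk'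
          (inv_ne_zero (mul_ne_zero hf1 (hpole _ p.rep_nonzero))))) _
      refine ⟨Projectivization.mk L _ hx0, ⟨(hBmem _).2 ⟨_, _, _, hX⟩, ?_⟩, ?_, ?_⟩
      · rw [SetLike.mem_coe, ← Projectivization.Subspace.mem_submodule_iff, hfl0]
        exact hPl
      · rw [SetLike.mem_coe, mem_fieldReduction_iff hx]
        exact Submodule.mem_span_singleton_self _
      · rw [SetLike.mem_coe, Projectivization.Subspace.mem_iff_of_submodule_eq hx, hfK]
        exact ⟨k, hfk⟩
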